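/- Let $R$ be an associative unital ring with involution, i.e. with an additive map $*:R\to R$ such that $(xy)^*=y^*x^*$ and $(x^*)^*=x$. A right ideal $J$ of $R$ is dense if for all $x,y\in R$ with $y\neq 0$ there is $r\in R$ with $xr\in J$ and $yr\neq 0$; dense left ideals are defined symmetrically. The maximal right ring of quotients is $Q^r_{\max}(R)=\varinjlim \mathrm{Hom}(J,R)$ over the dense right ideals $J$ (homomorphisms of right modules, two of which are identified if they agree on a dense right ideal; the product is composition), and $Q^l_{\max}(R)=\varinjlim \mathrm{Hom}(I,R)$ over the dense left ideals $I$ is its left analogue (with elements acting on the right). The maximal symmetric ring of quotients $Q_{\max}(R)$ consists of the classes of compatible pairs $(f,g)$, where $f:I\to R$ is a homomorphism of left modules on a dense left ideal $I$, $g:J\to R$ is a homomorphism of right modules on a dense right ideal $J$, and $f(i)j=i\,g(j)$ for all $i\in I$, $j\in J$; here $(f,g)\sim(h,k)$ if $f$ and $h$ agree on a dense left ideal and $g$ and $k$ agree on a dense right ideal, and the product is induced by those of $Q^l_{\max}(R)$ and $Q^r_{\max}(R)$. A ring homomorphism $R\to S$ makes $S$ a perfect right (respectively left) ring of quotients of $R$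 if it is an epimorphism of rings and $S$ is flat as a left (respectively right) $R$-module, and a perfect symmetric ring of quotients if it is an epimorphism of rings and $S$ is flat on both sides. The total right, left and symmetric rings of quotients $Q^r_{\mathrm{tot}}(R)\subseteq Q^r_{\max}(R)$, $Q^l_{\mathrm{tot}}(R)\subseteq Q^l_{\max}(R)$ and $Q_{\mathrm{tot}}(R)\subseteq Q_{\max}(R)$ are the subrings generated by all intermediate rings that are perfect right, left and symmetric rings of quotients of $R$, respectively. If $Q$ is one of these rings with its canonical map $\iota:R\to Q$, the involution of $R$ is said to extend to $Q$ if there is an involution on $Q$ with $\iota(r)^*=\iota(r^*)$ for all $r\in R$. Equality of two of these rings means that there is a ring isomorphism between them that is compatible with the canonical maps from $R$. Then: (i) The involution extends to $Q_{\max}(R)$ and to $Q_{\mathrm{tot}}(R)$. (ii) If the involution extends to $Q^r_{\max}(R)$ or to $Q^l_{\max}(R)$, then $Q^r_{\max}(R)=Q^l_{\max}(R)=Q_{\max}(R)$. (iii) If the involution extends to $Q^r_{\mathrm{tot}}(R)$ or to $Q^l_{\mathrm{tot}}(R)$, then $Q^r_{\mathrm{tot}}(R)=Q^l_{\mathrm{tot}}(R)=Q_{\mathrm{tot}}(R)$.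 -/

import Mathlib

universe u v w

open MulOpposite TensorProduct

noncomputable section

namespace QuotientRings

/-! ## Partial endomorphisms with dense domain -/

section DenseEnd

variable {A : Type u} [Ring A] {M : Type v} [AddCommGroup M] [Module A M]

/-- A submodule `N` of `M` is dense if for all `x y : M` with `y ≠ 0` there is a scalar `a` with
`a • x ∈ N` and `a • y ≠ 0`. For `M = R` over `A = R` these are the dense left ideals of `R`,
for `M = R` over `A = Rᵐᵒᵖ` the dense right ideals. -/
def IsDense (N : Submodule A M) : Prop :=
  ∀ x y : M, y ≠ 0 → ∃ a : A, a • x ∈ N ∧ a • y ≠ 0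

theorem IsDense.top : IsDense (⊤ : Submodule A M) := fun _ _ hy => ⟨1, trivial, by simpa using hy⟩

theorem IsDense.inf {N P : Submodule A M} (hN : IsDense N) (hP : IsDense P) :
    IsDense (N ⊓ P) := fun x y hy => by
  obtain ⟨a, ha, hay⟩ := hN x y hy
  obtain ⟨b, hb, hby⟩ := hP (a • x) (a • y) hay
  exact ⟨b * a, ⟨by rw [mul_smul]; exact N.smul_mem b ha, by rwa [mul_smul]⟩, by rwa [mul_smul]⟩

variable (A M) in
/-- Module homomorphisms `f : N → M` defined on a dense submodule `N` of `M`. -/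
abbrev DensePMap : Type _ := {f : M →ₗ.[A] M // IsDense f.domain}

/-- Composition of partial linear maps, on the set of all `x` for which `g (f x)` makes sense. -/
def pcomp (g f : M →ₗ.[A] M) : M →ₗ.[A] M where
  domain :=
    { carrier := {x | ∃ h : x ∈ f.domain, f ⟨x, h⟩ ∈ g.domain}
      zero_mem' := ⟨f.domain.zero_mem, by
        have : f ⟨0, f.domain.zero_mem⟩ = 0 := f.map_zero
        rw [this]; exact g.domain.zero_mem⟩
      add_mem' := by
        rintro x y ⟨hx, hx'⟩ ⟨hy, hy'⟩
        refine ⟨f.domain.add_mem hx hy, ?_⟩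
        have : f ⟨x + y, f.domain.add_mem hx hy⟩ = f ⟨x, hx⟩ + f ⟨y, hy⟩ := f.map_add ⟨x, hx⟩ ⟨y, hy⟩
        rw [this]; exact g.domain.add_mem hx' hy'
      smul_mem' := by
        rintro c x ⟨hx, hx'⟩
        refine ⟨f.domain.smul_mem c hx, ?_⟩
        have : f ⟨c • x, f.domain.smul_mem c hx⟩ = c • f ⟨x, hx⟩ := f.map_smul c ⟨x, hx⟩
        rw [this]; exact g.domain.smul_mem c hx' }
  toFun :=
    { toFun := fun x => g ⟨f ⟨x.1, x.2.1⟩, x.2.2⟩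
      map_add' := fun x y => by
        rw [← g.map_add]
        exact congrArg g (Subtype.ext (f.map_add ⟨x.1, x.2.1⟩ ⟨y.1, y.2.1⟩))
      map_smul' := fun c x => by
        rw [RingHom.id_apply, ← g.map_smul]
        exact congrArg g (Subtype.ext (f.map_smul c ⟨x.1, x.2.1⟩)) }

theorem IsDense.pcomp {g f : M →ₗ.[A] M} (hg : IsDense g.domain) (hf : IsDense f.domain) :
    IsDense (pcomp g f).domain := fun x y hy => by
  obtain ⟨a, ha, hay⟩ := hf x y hy
  obtain ⟨b, hb, hby⟩ := hg (f ⟨a • x, ha⟩) (a • y) hay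
  refine ⟨b * a, ?_, by rwa [mul_smul]⟩
  rw [mul_smul]
  refine ⟨f.domain.smul_mem b ha, ?_⟩
  have : f ⟨b • a • x, f.domain.smul_mem b ha⟩ = b • f ⟨a • x, ha⟩ := f.map_smul b ⟨a • x, ha⟩
  rw [this]; exact hb

/-- Two partial endomorphisms are identified if they are defined and agree on a common dense
submodule. -/
def AgreeDensely (f g : M →ₗ.[A] M) : Prop :=
  ∃ N : Submodule A M, IsDense N ∧
    ∀ x ∈ N, ∃ (hf : x ∈ f.domain) (hg : x ∈ g.domain), f ⟨x, hf⟩ = g ⟨x, hg⟩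

variable (A M) in
instance denseSetoid : Setoid (DensePMap A M) where
  r f g := AgreeDensely f.1 g.1
  iseqv :=
    { refl := fun f => ⟨f.1.domain, f.2, fun _ hx => ⟨hx, hx, rfl⟩⟩
      symm := fun ⟨N, hN, h⟩ => ⟨N, hN, fun x hx => by
        obtain ⟨hf, hg, e⟩ := h x hx
        exact ⟨hg, hf, e.symm⟩⟩
      trans := fun ⟨N, hN, h⟩ ⟨P, hP, k⟩ => ⟨N ⊓ P, hN.inf hP, fun x hx => by
        obtain ⟨hf, hg, e⟩ := h x hx.1
        obtain ⟨hg', hk, e'⟩ := k x hx.2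
        exact ⟨hf, hk, e.trans e'⟩⟩ }

variable (A M) in
/-- The direct limit `lim Hom_A(N, M)` over the dense submodules `N` of `M`. -/
def DenseEnd : Type _ := Quotient (denseSetoid A M)

namespace DenseEnd

/-- The class of a densely defined partial endomorphism. -/
def mk (f : DensePMap A M) : DenseEnd A M := Quotient.mk _ f

theorem mk_eq_mk {f g : DensePMap A M} : mk f = mk g ↔ AgreeDensely f.1 g.1 := Quotient.eq

theorem mk_eq_of {f g : DensePMap A M}
    (h : ∀ x (hf : x ∈ f.1.domain) (hg : x ∈ g.1.domain), f.1 ⟨x, hf⟩ = g.1 ⟨x, hg⟩) :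
    mk f = mk g :=
  mk_eq_mk.2 ⟨f.1.domain ⊓ g.1.domain, f.2.inf g.2, fun x hx => ⟨hx.1, hx.2, h x hx.1 hx.2⟩⟩

instance : Zero (DenseEnd A M) := ⟨mk ⟨0, IsDense.top⟩⟩

instance : One (DenseEnd A M) :=
  ⟨mk ⟨(LinearMap.id : M →ₗ[A] M).toPMap ⊤, IsDense.top⟩⟩

instance : Neg (DenseEnd A M) :=
  ⟨Quotient.map (fun f => ⟨-f.1, f.2⟩) fun _ _ ⟨N, hN, h⟩ => ⟨N, hN, fun x hx => by
    obtain ⟨hf, hg, e⟩ := h x hx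
    exact ⟨hf, hg, congrArg Neg.neg e⟩⟩⟩

instance : Add (DenseEnd A M) :=
  ⟨Quotient.map₂ (fun f g => ⟨f.1 + g.1, f.2.inf g.2⟩)
    fun _ _ ⟨N, hN, h⟩ _ _ ⟨P, hP, k⟩ => ⟨N ⊓ P, hN.inf hP, fun x hx => by
      obtain ⟨hf, hg, e⟩ := h x hx.1
      obtain ⟨hf', hg', e'⟩ := k x hx.2
      exact ⟨⟨hf, hf'⟩, ⟨hg, hg'⟩, congrArg₂ (· + ·) e e'⟩⟩⟩

/-- Multiplication is composition. -/
instance : Mul (DenseEnd A M) :=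
  ⟨Quotient.map₂ (fun g f => ⟨pcomp g.1 f.1, g.2.pcomp f.2⟩)
    fun g g' ⟨N, hN, h⟩ f f' ⟨P, hP, k⟩ => by
      let fP : M →ₗ.[A] M := f.1.domRestrict P
      have hle : P ≤ f.1.domain := fun x hx => (k x hx).1
      have hfP : IsDense fP.domain := by
        have : fP.domain = P := inf_eq_left.2 hle
        rw [this]; exact hP
      let gN : M →ₗ.[A] M := g.1.domRestrict N
      have hgN : IsDense gN.domain := by
        have : gN.domain = N := inf_eq_left.2 fun x hx => (h x hx).1
        rw [this]; exact hN
      refine ⟨(pcomp gN fP).domain, hgN.pcomp hfP, ?_⟩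
      rintro x ⟨hx, hx'⟩
      obtain ⟨hf, hf', e⟩ := k x hx.1
      have hx'' : f.1 ⟨x, hf⟩ ∈ N := hx'.1
      obtain ⟨hg, hg', e'⟩ := h _ hx''
      refine ⟨⟨hf, hg⟩, ⟨hf', by rw [← e]; exact hg'⟩, e'.trans ?_⟩
      exact congrArg g'.1 (Subtype.ext e)⟩

theorem mk_add (f g : DensePMap A M) : mk f + mk g = mk ⟨f.1 + g.1, f.2.inf g.2⟩ := rfl

theorem mk_mul (g f : DensePMap A M) : mk g * mk f = mk ⟨pcomp g.1 f.1, g.2.pcomp f.2⟩ := rfl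

theorem mk_neg (f : DensePMap A M) : -mk f = mk ⟨-f.1, f.2⟩ := rfl

theorem one_def :
    (1 : DenseEnd A M) = mk ⟨(LinearMap.id : M →ₗ[A] M).toPMap ⊤, IsDense.top⟩ := rfl

theorem zero_def : (0 : DenseEnd A M) = mk ⟨0, IsDense.top⟩ := rfl

protected theorem ind {p : DenseEnd A M → Prop} (h : ∀ f, p (mk f)) (q : DenseEnd A M) : p q :=
  Quotient.ind h q

instance : Ring (DenseEnd A M) where
  add_assoc a b c := by
    induction a using DenseEnd.ind; induction b using DenseEnd.ind; induction c using DenseEnd.ind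
    exact mk_eq_of fun x _ _ => add_assoc _ _ _
  zero_add a := by
    induction a using DenseEnd.ind
    exact mk_eq_of fun x _ _ => zero_add _
  add_zero a := by
    induction a using DenseEnd.ind
    exact mk_eq_of fun x _ _ => add_zero _
  add_comm a b := by
    induction a using DenseEnd.ind; induction b using DenseEnd.ind
    exact mk_eq_of fun x _ _ => add_comm _ _
  neg_add_cancel a := by
    induction a using DenseEnd.ind
    exact mk_eq_of fun x _ _ => neg_add_cancel _
  mul_assoc a b c := by
    induction a using DenseEnd.ind; induction b using DenseEnd.ind; induction c using DenseEnd.ind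
    exact mk_eq_of fun x _ _ => rfl
  one_mul a := by
    induction a using DenseEnd.ind
    exact mk_eq_of fun x _ _ => rfl
  mul_one a := by
    induction a using DenseEnd.ind
    exact mk_eq_of fun x _ _ => rfl
  zero_mul a := by
    induction a using DenseEnd.ind
    exact mk_eq_of fun x _ _ => rfl
  mul_zero a := by
    induction a using DenseEnd.ind with | h f =>
    exact mk_eq_of fun x _ _ => f.1.map_zero
  left_distrib a b c := by
    induction a using DenseEnd.ind with | h f =>
    induction b using DenseEnd.ind with | h g =>
    induction c using DenseEnd.ind with | h k =>
    exact mk_eq_of fun x h₁ h₂ => f.1.map_add ⟨_, h₂.1.2⟩ ⟨_, h₂.2.2⟩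
  right_distrib a b c := by
    induction a using DenseEnd.ind; induction b using DenseEnd.ind; induction c using DenseEnd.ind
    exact mk_eq_of fun x _ _ => rfl
  nsmul := nsmulRec
  zsmul := zsmulRec

/-- The class of an everywhere defined endomorphism. -/
def ofEnd (f : M →ₗ[A] M) : DenseEnd A M := mk ⟨f.toPMap ⊤, IsDense.top⟩

end DenseEnd

end DenseEnd

/-! ## The maximal rings of quotients -/

section Max

variable (R : Type u) [Ring R]

/-- The maximal right ring of quotients: the direct limit of `Hom(J, R)` over the dense right
ideals `J`, the homomorphisms being homomorphisms of right `R`-modules. -/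
abbrev MaxRight : Type u := DenseEnd Rᵐᵒᵖ R

/-- The maximal left ring of quotients: the direct limit of `Hom(I, R)` over the dense left ideals
`I`, the homomorphisms being homomorphisms of left `R`-modules. An element `q` acts on the right,
`f i = i * q`, hence the product is composition in the reverse order. -/
abbrev MaxLeft : Type u := (DenseEnd R R)ᵐᵒᵖ

variable {R} in
/-- Left multiplication by `r`, a homomorphism of right modules. -/
def leftMul (r : R) : R →ₗ[Rᵐᵒᵖ] R where
  toFun j := r * j
  map_add' x y := mul_add r x y
  map_smul' c x := (mul_assoc r x c.unop).symm

variable {R} in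
/-- Right multiplication by `r`, a homomorphism of left modules. -/
def rightMul (r : R) : R →ₗ[R] R where
  toFun i := i * r
  map_add' x y := add_mul x y r
  map_smul' c x := mul_assoc c x r

/-- The canonical map `R → MaxRight R`: `r` goes to the class of `j ↦ r * j`. -/
def toMaxRight : R →+* MaxRight R where
  toFun r := DenseEnd.ofEnd (leftMul r)
  map_one' := DenseEnd.mk_eq_of fun x _ _ => one_mul x
  map_mul' r s := DenseEnd.mk_eq_of fun x _ _ => mul_assoc r s x
  map_zero' := DenseEnd.mk_eq_of fun x _ _ => zero_mul x
  map_add' r s := DenseEnd.mk_eq_of fun x _ _ => add_mul r s x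

/-- The canonical map `R → MaxLeft R`: `r` goes to the class of `i ↦ i * r`. -/
def toMaxLeft : R →+* MaxLeft R where
  toFun r := op (DenseEnd.ofEnd (rightMul r))
  map_one' := congrArg op (DenseEnd.mk_eq_of fun x _ _ => mul_one x)
  map_mul' r s := congrArg op (DenseEnd.mk_eq_of fun x _ _ => (mul_assoc x r s).symm)
  map_zero' := congrArg op (DenseEnd.mk_eq_of fun x _ _ => mul_zero x)
  map_add' r s := congrArg op (DenseEnd.mk_eq_of fun x _ _ => mul_add x r s)

theorem toMaxRight_injective : Function.Injective (toMaxRight R) := by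
  intro r s h
  obtain ⟨N, hN, h⟩ := DenseEnd.mk_eq_mk.1 h
  by_contra hrs
  obtain ⟨a, ha, ha'⟩ := hN 1 (r - s) (sub_ne_zero.2 hrs)
  obtain ⟨_, _, e⟩ := h _ ha
  apply ha'
  have e' : r * (1 * a.unop) = s * (1 * a.unop) := e
  change (r - s) * a.unop = 0
  rw [sub_mul, sub_eq_zero]
  simpa using e'

theorem toMaxLeft_injective : Function.Injective (toMaxLeft R) := by
  intro r s h
  obtain ⟨N, hN, h⟩ := DenseEnd.mk_eq_mk.1 (op_injective h)
  by_contra hrs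
  obtain ⟨a, ha, ha'⟩ := hN 1 (r - s) (sub_ne_zero.2 hrs)
  obtain ⟨_, _, e⟩ := h _ ha
  apply ha'
  have e' : a * 1 * r = a * 1 * s := e
  change a * (r - s) = 0
  rw [mul_sub, sub_eq_zero]
  simpa using e'

variable {R} in
/-- A homomorphism of left modules `f : I → R` and a homomorphism of right modules `g : J → R`
form a compatible pair if `f i * j = i * g j` for all `i ∈ I` and `j ∈ J`. -/
def Compatible (f : R →ₗ.[R] R) (g : R →ₗ.[Rᵐᵒᵖ] R) : Prop :=
  ∀ (i : f.domain) (j : g.domain), f i * (j : R) = (i : R) * g j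

/-- The maximal symmetric ring of quotients: the classes of compatible pairs `(f, g)` with dense
domains, where `(f, g) ∼ (h, k)` if `f` and `h` agree on a dense left ideal and `g` and `k` agree
on a dense right ideal. -/
def MaxSymm : Subring (MaxLeft R × MaxRight R) where
  carrier := {q | ∃ (f : DensePMap R R) (g : DensePMap Rᵐᵒᵖ R), Compatible f.1 g.1 ∧
    q = (op (DenseEnd.mk f), DenseEnd.mk g)}
  zero_mem' := ⟨⟨0, IsDense.top⟩, ⟨0, IsDense.top⟩,
    fun i j => (zero_mul (j : R)).trans (mul_zero (i : R)).symm, rfl⟩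
  one_mem' := ⟨⟨LinearMap.id.toPMap ⊤, IsDense.top⟩, ⟨LinearMap.id.toPMap ⊤, IsDense.top⟩,
    fun _ _ => rfl, rfl⟩
  neg_mem' := by
    rintro _ ⟨f, g, h, rfl⟩
    exact ⟨⟨-f.1, f.2⟩, ⟨-g.1, g.2⟩, fun i j => by
      have e : f.1 i * (j : R) = (i : R) * g.1 j := h i j
      exact (neg_mul _ _).trans ((congrArg Neg.neg e).trans (mul_neg _ _).symm), rfl⟩
  add_mem' := by
    rintro _ _ ⟨f, g, h, rfl⟩ ⟨f', g', h', rfl⟩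
    exact ⟨⟨f.1 + f'.1, f.2.inf f'.2⟩, ⟨g.1 + g'.1, g.2.inf g'.2⟩, fun i j =>
      (add_mul _ _ _).trans ((congrArg₂ (· + ·) (h ⟨i, i.2.1⟩ ⟨j, j.2.1⟩)
        (h' ⟨i, i.2.2⟩ ⟨j, j.2.2⟩)).trans (mul_add _ _ _).symm), rfl⟩
  mul_mem' := by
    rintro _ _ ⟨f, g, h, rfl⟩ ⟨f', g', h', rfl⟩
    exact ⟨⟨pcomp f'.1 f.1, f'.2.pcomp f.2⟩, ⟨pcomp g.1 g'.1, g.2.pcomp g'.2⟩, fun i j =>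
      (h' ⟨f.1 ⟨i, i.2.1⟩, i.2.2⟩ ⟨j, j.2.1⟩).trans
        (h ⟨i, i.2.1⟩ ⟨g'.1 ⟨j, j.2.1⟩, j.2.2⟩), rfl⟩

/-- The canonical map `R → MaxSymm R`: `r` goes to the class of `(i ↦ i * r, j ↦ r * j)`. -/
def toMaxSymm : R →+* MaxSymm R :=
  ((toMaxLeft R).prod (toMaxRight R)).codRestrict (MaxSymm R) fun r =>
    ⟨⟨(rightMul r).toPMap ⊤, IsDense.top⟩, ⟨(leftMul r).toPMap ⊤, IsDense.top⟩,
      fun i j => mul_assoc (i : R) r (j : R), rfl⟩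

theorem toMaxSymm_injective : Function.Injective (toMaxSymm R) := fun _ _ h =>
  toMaxRight_injective R (congrArg (fun q : MaxSymm R => q.1.2) h)

end Max

/-! ## Tensor products and flatness over a noncommutative ring -/

section Flat

variable (A : Type u) [Ring A]

/-- The subgroup of `N ⊗_ℤ B` generated by all `n a ⊗ b - n ⊗ a b`. -/
def balancedRel (N : Type v) [AddCommGroup N] [Module Aᵐᵒᵖ N] (B : Type w) [AddCommGroup B]
    [Module A B] : AddSubgroup (N ⊗[ℤ] B) :=
  AddSubgroup.closure {t | ∃ (n : N) (a : A) (b : B), t = (op a • n) ⊗ₜ[ℤ] b - n ⊗ₜ[ℤ] (a • b)}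

/-- The tensor product `N ⊗_A B` of a right module `N` and a left module `B` over a ring `A`. -/
abbrev BalancedTensor (N : Type v) [AddCommGroup N] [Module Aᵐᵒᵖ N] (B : Type w) [AddCommGroup B]
    [Module A B] : Type _ := (N ⊗[ℤ] B) ⧸ balancedRel A N B

variable {A}
variable {N N' : Type v} [AddCommGroup N] [Module Aᵐᵒᵖ N] [AddCommGroup N'] [Module Aᵐᵒᵖ N']
variable {B B' : Type w} [AddCommGroup B] [Module A B] [AddCommGroup B'] [Module A B']

/-- The homomorphism `f ⊗ g : N ⊗_A B → N' ⊗_A B'` induced by module homomorphisms. -/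
def BalancedTensor.map (f : N →ₗ[Aᵐᵒᵖ] N') (g : B →ₗ[A] B') :
    BalancedTensor A N B →+ BalancedTensor A N' B' :=
  QuotientAddGroup.map _ _
    (TensorProduct.map f.toAddMonoidHom.toIntLinearMap
      g.toAddMonoidHom.toIntLinearMap).toAddMonoidHom <| by
    rw [balancedRel, AddSubgroup.closure_le]
    rintro _ ⟨n, a, b, rfl⟩
    refine AddSubgroup.subset_closure ⟨f n, a, g b, ?_⟩
    simp

variable (A)

/-- A left module `B` is flat if `- ⊗_A B` preserves injectivity of homomorphisms of right
modules. -/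
def FlatLeftModule (B : Type u) [AddCommGroup B] [Module A B] : Prop :=
  ∀ (N N' : Type u) [AddCommGroup N] [Module Aᵐᵒᵖ N] [AddCommGroup N'] [Module Aᵐᵒᵖ N']
    (f : N →ₗ[Aᵐᵒᵖ] N'), Function.Injective f →
    Function.Injective (BalancedTensor.map f (LinearMap.id : B →ₗ[A] B))

/-- A right module `N` is flat if `N ⊗_A -` preserves injectivity of homomorphisms of left
modules. -/
def FlatRightModule (N : Type u) [AddCommGroup N] [Module Aᵐᵒᵖ N] : Prop :=
  ∀ (B B' : Type u) [AddCommGroup B] [Module A B] [AddCommGroup B'] [Module A B']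
    (g : B →ₗ[A] B'), Function.Injective g →
    Function.Injective (BalancedTensor.map (LinearMap.id : N →ₗ[Aᵐᵒᵖ] N) g)

end Flat

/-! ## Perfect localizations and the total rings of quotients -/

section Tot

/-- `S` is a perfect right ring of quotients of `R` via `φ`: `φ` is an epimorphism of rings and
`S` is flat as a left `R`-module. -/
def IsPerfectRight {R S : Type u} [Ring R] [Ring S] (φ : R →+* S) : Prop :=
  CategoryTheory.Epi (RingCat.ofHom φ) ∧
    letI : Module R S := Module.compHom S φ
    FlatLeftModule R S

/-- `S` is a perfect left ring of quotients of `R` via `φ`: `φ` is an epimorphism of rings and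
`S` is flat as a right `R`-module. -/
def IsPerfectLeft {R S : Type u} [Ring R] [Ring S] (φ : R →+* S) : Prop :=
  CategoryTheory.Epi (RingCat.ofHom φ) ∧
    letI : Module Rᵐᵒᵖ S := Module.compHom S φ.op
    FlatRightModule R S

/-- `S` is a perfect symmetric ring of quotients of `R` via `φ`: `φ` is an epimorphism of rings
and `S` is flat both as a left and as a right `R`-module. -/
def IsPerfectSymm {R S : Type u} [Ring R] [Ring S] (φ : R →+* S) : Prop :=
  IsPerfectLeft φ ∧ IsPerfectRight φ

theorem epi_of_bijective {R S : Type u} [Ring R] [Ring S] (φ : R →+* S)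
    (h : Function.Bijective φ) : CategoryTheory.Epi (RingCat.ofHom φ) :=
  CategoryTheory.ConcreteCategory.epi_of_surjective _ h.2

theorem IsPerfectRight.of_bijective {R S : Type u} [Ring R] [Ring S] (φ : R →+* S)
    (h : Function.Bijective φ) : IsPerfectRight φ := by
  refine ⟨epi_of_bijective φ h, ?_⟩
  let _ : Module R S := Module.compHom S φ
  intro N N' _ _ _ _ f hf
  let ψ : S ≃+* R := (RingEquiv.ofBijective φ h).symm
  have hφψ : ∀ s, φ (ψ s) = s := fun s => (RingEquiv.ofBijective φ h).apply_symm_apply s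
  have hψφ : ∀ r, ψ (φ r) = r := fun r => (RingEquiv.ofBijective φ h).symm_apply_apply r
  have key : ∀ x : BalancedTensor R N S, ∃ n : N,
      x = QuotientAddGroup.mk (n ⊗ₜ[ℤ] (1 : S)) := by
    intro x
    obtain ⟨t, rfl⟩ := QuotientAddGroup.mk_surjective x
    induction t with
    | zero => exact ⟨0, by rw [TensorProduct.zero_tmul]⟩
    | tmul n s =>
      refine ⟨op (ψ s) • n, ?_⟩
      symm
      rw [QuotientAddGroup.eq_iff_sub_mem]
      refine AddSubgroup.subset_closure ⟨n, ψ s, 1, ?_⟩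
      have : (ψ s • (1 : S)) = s := (mul_one _).trans (hφψ s)
      rw [this]
    | add a b ha hb =>
      obtain ⟨n, hn⟩ := ha
      obtain ⟨m, hm⟩ := hb
      exact ⟨n + m, by rw [QuotientAddGroup.mk_add, hn, hm, TensorProduct.add_tmul]; rfl⟩
  let μ : N' ⊗[ℤ] S →ₗ[ℤ] N' := TensorProduct.lift
    (AddMonoidHom.toIntLinearMap
      { toFun := fun n => AddMonoidHom.toIntLinearMap
          { toFun := fun s => op (ψ s) • n
            map_zero' := by simp
            map_add' := fun s t => by rw [map_add, op_add, add_smul] }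
        map_zero' := by ext; simp
        map_add' := fun n m => by ext; simp })
  have hμ : ∀ t ∈ balancedRel R N' S, μ t = 0 := by
    intro t ht
    refine AddSubgroup.closure_induction ?_ (map_zero μ) (fun a b _ _ ha hb => by
      rw [map_add, ha, hb, add_zero]) (fun a _ ha => by rw [map_neg, ha, neg_zero]) ht
    rintro _ ⟨n, a, b, rfl⟩
    have e : ψ (a • b) = a * ψ b := by
      rw [show a • b = φ a * b from rfl, map_mul, hψφ]
    rw [map_sub, sub_eq_zero]
    change op (ψ b) • op a • n = op (ψ (a • b)) • n
    rw [e, op_mul, mul_smul]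
  rw [injective_iff_map_eq_zero]
  intro x hx
  obtain ⟨n, rfl⟩ := key x
  have h0 : (f n) ⊗ₜ[ℤ] (1 : S) ∈ balancedRel R N' S := (QuotientAddGroup.eq_zero_iff _).1 hx
  have h1 : op (ψ 1) • f n = 0 := hμ _ h0
  rw [map_one, op_one, one_smul] at h1
  rw [(map_eq_zero_iff f hf).1 h1, TensorProduct.zero_tmul]
  rfl

theorem IsPerfectLeft.of_bijective {R S : Type u} [Ring R] [Ring S] (φ : R →+* S)
    (h : Function.Bijective φ) : IsPerfectLeft φ := by
  refine ⟨epi_of_bijective φ h, ?_⟩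
  let _ : Module Rᵐᵒᵖ S := Module.compHom S φ.op
  intro N N' _ _ _ _ f hf
  let ψ : S ≃+* R := (RingEquiv.ofBijective φ h).symm
  have hφψ : ∀ s, φ (ψ s) = s := fun s => (RingEquiv.ofBijective φ h).apply_symm_apply s
  have hψφ : ∀ r, ψ (φ r) = r := fun r => (RingEquiv.ofBijective φ h).symm_apply_apply r
  have key : ∀ x : BalancedTensor R S N, ∃ n : N,
      x = QuotientAddGroup.mk ((1 : S) ⊗ₜ[ℤ] n) := by
    intro x
    obtain ⟨t, rfl⟩ := QuotientAddGroup.mk_surjective x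
    induction t with
    | zero => exact ⟨0, by rw [TensorProduct.tmul_zero]⟩
    | tmul s n =>
      refine ⟨ψ s • n, ?_⟩
      rw [QuotientAddGroup.eq_iff_sub_mem]
      refine AddSubgroup.subset_closure ⟨1, ψ s, n, ?_⟩
      have : (op (ψ s) • (1 : S)) = s := (one_mul _).trans (hφψ s)
      rw [this]
    | add a b ha hb =>
      obtain ⟨n, hn⟩ := ha
      obtain ⟨m, hm⟩ := hb
      exact ⟨n + m, by rw [QuotientAddGroup.mk_add, hn, hm, TensorProduct.tmul_add]; rfl⟩
  let μ : S ⊗[ℤ] N' →ₗ[ℤ] N' := TensorProduct.lift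
    (AddMonoidHom.toIntLinearMap
      { toFun := fun s => AddMonoidHom.toIntLinearMap
          { toFun := fun n => ψ s • n
            map_zero' := by simp
            map_add' := fun n m => smul_add _ n m }
        map_zero' := by ext; simp
        map_add' := fun s t => by ext; simp [add_smul] })
  have hμ : ∀ t ∈ balancedRel R S N', μ t = 0 := by
    intro t ht
    refine AddSubgroup.closure_induction ?_ (map_zero μ) (fun a b _ _ ha hb => by
      rw [map_add, ha, hb, add_zero]) (fun a _ ha => by rw [map_neg, ha, neg_zero]) ht
    rintro _ ⟨s, a, n, rfl⟩
    have e : ψ (op a • s) = ψ s * a := by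
      rw [show op a • s = s * φ a from rfl, map_mul, hψφ]
    rw [map_sub, sub_eq_zero]
    change ψ (op a • s) • n = ψ s • a • n
    rw [e, mul_smul]
  rw [injective_iff_map_eq_zero]
  intro x hx
  obtain ⟨n, rfl⟩ := key x
  have h0 : (1 : S) ⊗ₜ[ℤ] (f n) ∈ balancedRel R S N' := (QuotientAddGroup.eq_zero_iff _).1 hx
  have h1 : ψ 1 • f n = 0 := hμ _ h0
  rw [map_one, one_smul] at h1
  rw [(map_eq_zero_iff f hf).1 h1, TensorProduct.tmul_zero]
  rfl

theorem bijective_codRestrict_range {R Q : Type u} [Ring R] [Ring Q] (φ : R →+* Q)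
    (hφ : Function.Injective φ) :
    Function.Bijective (φ.codRestrict φ.range fun r => ⟨r, rfl⟩) :=
  ⟨fun _ _ h => hφ (congrArg Subtype.val h), fun ⟨_, r, hr⟩ => ⟨r, Subtype.ext hr⟩⟩

variable (R : Type u) [Ring R]

/-- The total right ring of quotients: the largest subring of the maximal right ring of quotients
that is a perfect right ring of quotients of `R`, obtained as the subring generated by all
intermediate rings `R ⊆ S` that are perfect right rings of quotients of `R`. -/
def TotRight : Subring (MaxRight R) :=
  sSup {S | ∃ h : ∀ r, toMaxRight R r ∈ S, IsPerfectRight ((toMaxRight R).codRestrict S h)}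

/-- The total left ring of quotients: the largest subring of the maximal left ring of quotients
that is a perfect left ring of quotients of `R`, obtained as the subring generated by all
intermediate rings `R ⊆ S` that are perfect left rings of quotients of `R`. -/
def TotLeft : Subring (MaxLeft R) :=
  sSup {S | ∃ h : ∀ r, toMaxLeft R r ∈ S, IsPerfectLeft ((toMaxLeft R).codRestrict S h)}

/-- The total symmetric ring of quotients: the largest subring of the maximal symmetric ring of
quotients that is a perfect symmetric ring of quotients of `R`, obtained as the subring generated
by all intermediate rings `R ⊆ S` that are perfect symmetric rings of quotients of `R`. -/
def TotSymm : Subring (MaxSymm R) :=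
  sSup {S | ∃ h : ∀ r, toMaxSymm R r ∈ S, IsPerfectSymm ((toMaxSymm R).codRestrict S h)}

theorem toMaxRight_mem (r : R) : toMaxRight R r ∈ TotRight R :=
  (le_sSup ⟨fun r => ⟨r, rfl⟩, IsPerfectRight.of_bijective _
    (bijective_codRestrict_range _ (toMaxRight_injective R))⟩ : (toMaxRight R).range ≤ TotRight R) ⟨r, rfl⟩

theorem toMaxLeft_mem (r : R) : toMaxLeft R r ∈ TotLeft R :=
  (le_sSup ⟨fun r => ⟨r, rfl⟩, IsPerfectLeft.of_bijective _
    (bijective_codRestrict_range _ (toMaxLeft_injective R))⟩ : (toMaxLeft R).range ≤ TotLeft R) ⟨r, rfl⟩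

theorem toMaxSymm_mem (r : R) : toMaxSymm R r ∈ TotSymm R :=
  (le_sSup ⟨fun r => ⟨r, rfl⟩,
    IsPerfectLeft.of_bijective _ (bijective_codRestrict_range _ (toMaxSymm_injective R)),
    IsPerfectRight.of_bijective _ (bijective_codRestrict_range _ (toMaxSymm_injective R))⟩ : (toMaxSymm R).range ≤ TotSymm R) ⟨r, rfl⟩

/-- The canonical map `R → TotRight R`. -/
def toTotRight : R →+* TotRight R := (toMaxRight R).codRestrict _ (toMaxRight_mem R)

/-- The canonical map `R → TotLeft R`. -/
def toTotLeft : R →+* TotLeft R := (toMaxLeft R).codRestrict _ (toMaxLeft_mem R)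

/-- The canonical map `R → TotSymm R`. -/
def toTotSymm : R →+* TotSymm R := (toMaxSymm R).codRestrict _ (toMaxSymm_mem R)

end Tot

/-! ## Extension of involutions and equality of rings of quotients -/

/-- The involution of `R` extends to `Q` along `ι`: there is an involution on the ring `Q` that
makes `ι` a homomorphism of rings with involution. -/
def InvolutionExtends {R Q : Type u} [Ring R] [StarRing R] [Ring Q] (ι : R →+* Q) : Prop :=
  ∃ _ : StarRing Q, ∀ r : R, star (ι r) = ι (star r)

/-- Two rings of quotients of `R` are equal: they are isomorphic as rings over `R`. -/
def EqualOver {R Q Q' : Type u} [Ring R] [Ring Q] [Ring Q'] (ι : R →+* Q) (ι' : R →+* Q') : Prop :=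
  ∃ e : Q ≃+* Q', ∀ r : R, e (ι r) = ι' r

end QuotientRings

end

/-! Conjugating a partial endomorphism by `*` exchanges left and right ideals and preserves density,
so it gives an antiisomorphism `starMax` from `MaxLeft R` to `MaxRight R` lying over the involution
of `R`. It turns a compatible pair `(f, g)` into the compatible pair `(g*, f*)`, which is the
involution on `MaxSymm R`. An antiisomorphism over `*` exchanges perfect left and perfect right
rings of quotients, so `TotSymm R` is stable under this involution, and `starMax` restricts to an
antiisomorphism `starTot` from `TotLeft R` to `TotRight R`.

If the involution extends to one of the two one-sided rings, composing the extension with the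
antiisomorphism gives a genuine isomorphism `e` over `R` from the right ring to the left ring. Each
`x` on the right then yields a pair `(e x, x)`, which is compatible because both components come
from one ring over `R` (`prod_mem_maxSymm`). Since the projection `MaxSymm R → MaxRight R` is
injective (`maxSymm_snd_injective`), `x ↦ (e x, x)` is onto `MaxSymm R` in the maximal case.

In the total case its image must be identified with `TotSymm R`. For this `TotRight R`, defined only
as a ring generated by perfect ones, has to be perfect itself. This rests on an elementwise
criterion: an extension `S` of `R` is a perfect right ring of quotients if and only if `(R : s) S =
S` for all `s` in `S`, where `(R : s) = {r | s r ∈ R}`. The elements satisfying (a stable form of)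
this condition form a subring, hence the criterion passes to generated subrings
(`isPerfectRight_sSup`). -/

noncomputable section
namespace QuotientRings

/-! ## Right ideals of denominators -/

section Denominators

variable {R S : Type u} [Ring R] [Ring S]

/-- The right ideal `J` of `R` generates the unit right ideal of `S`, i.e. `J S = S`. -/
def GeneratesUnit (φ : R →+* S) (J : Submodule Rᵐᵒᵖ R) : Prop :=
  (1 : S) ∈ Submodule.span Sᵐᵒᵖ (φ '' (J : Set R))

/-- The right ideal of all `r : R` such that `s * φ r` lies in the image of `R`. -/
def denominators (φ : R →+* S) (s : S) : Submodule Rᵐᵒᵖ R where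
  carrier := {r | s * φ r ∈ φ.range}
  zero_mem' := ⟨0, by simp⟩
  add_mem' {a b} ha hb := by
    rw [Set.mem_ofPred_eq, map_add, mul_add]
    exact add_mem ha hb
  smul_mem' c r hr := by
    rw [Set.mem_ofPred_eq, show c • r = r * c.unop from rfl, map_mul, ← mul_assoc]
    exact mul_mem hr ⟨_, rfl⟩

theorem mem_denominators {φ : R →+* S} {s : S} {r : R} :
    r ∈ denominators φ s ↔ ∃ a, φ a = s * φ r := Iff.rfl

/-- Every element of `S` has enough right denominators in `R`: `(R : s) S = S` for all `s`. -/
def HasDenominators (φ : R →+* S) : Prop := ∀ s, GeneratesUnit φ (denominators φ s)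

variable {φ : R →+* S}

theorem GeneratesUnit.mono {J K : Submodule Rᵐᵒᵖ R} (hJ : GeneratesUnit φ J) (h : J ≤ K) :
    GeneratesUnit φ K :=
  Submodule.span_mono (Set.image_mono h) hJ

theorem GeneratesUnit.top : GeneratesUnit φ ⊤ := Submodule.subset_span ⟨1, trivial, map_one φ⟩

theorem GeneratesUnit.mem_span {J : Submodule Rᵐᵒᵖ R} (hJ : GeneratesUnit φ J) (s : S) :
    s ∈ Submodule.span Sᵐᵒᵖ (φ '' (J : Set R)) := by
  have := Submodule.smul_mem _ (op s) hJ
  rwa [op_smul_eq_mul, one_mul] at this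

/-- For `r ∈ J` one has `φ r = φ r * 1 ∈ φ r D S ⊆ K S`, hence `S = J S ⊆ K S`. This is the
transitivity axiom of a Gabriel filter, and most constructions of right ideals below go through it.
-/
theorem GeneratesUnit.trans {J K : Submodule Rᵐᵒᵖ R} (hJ : GeneratesUnit φ J)
    (h : ∀ r ∈ J, ∃ D : Submodule Rᵐᵒᵖ R, GeneratesUnit φ D ∧ ∀ d ∈ D, r * d ∈ K) :
    GeneratesUnit φ K := by
  refine Submodule.span_le.2 ?_ hJ
  rintro _ ⟨r, hr, rfl⟩
  obtain ⟨D, hD, hDK⟩ := h r hr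
  have : ∀ x ∈ Submodule.span Sᵐᵒᵖ (φ '' (D : Set R)),
      φ r * x ∈ Submodule.span Sᵐᵒᵖ (φ '' (K : Set R)) := by
    intro x hx
    induction hx using Submodule.span_induction with
    | mem x hx =>
      obtain ⟨d, hd, rfl⟩ := hx
      exact Submodule.subset_span ⟨r * d, hDK d hd, map_mul φ r d⟩
    | zero => simp
    | add x y _ _ hx hy => rw [mul_add]; exact add_mem hx hy
    | smul c x _ hx =>
      rw [show c • x = x * c.unop from rfl, ← mul_assoc]
      exact Submodule.smul_mem _ c hx
  simpa using this 1 hD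

theorem GeneratesUnit.comp {T : Type u} [Ring T] (i : S →+* T) {J : Submodule Rᵐᵒᵖ R}
    (hJ : GeneratesUnit φ J) : GeneratesUnit (i.comp φ) J := by
  have : ∀ x ∈ Submodule.span Sᵐᵒᵖ (φ '' (J : Set R)),
      i x ∈ Submodule.span Tᵐᵒᵖ (i.comp φ '' (J : Set R)) := by
    intro x hx
    induction hx using Submodule.span_induction with
    | mem x hx =>
      obtain ⟨d, hd, rfl⟩ := hx
      exact Submodule.subset_span ⟨d, hd, rfl⟩
    | zero => simp
    | add x y _ _ hx hy => rw [map_add]; exact add_mem hx hy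
    | smul c x _ hx =>
      rw [show c • x = x * c.unop from rfl, map_mul]
      exact Submodule.smul_mem _ (op (i c.unop)) hx
  simpa [GeneratesUnit] using this 1 hJ

/-- If `r ∈ J` and `d` is a denominator of `s * φ r`, then `r * d` lies in `J` and is a denominator
of `s`. This special intersection needs no injectivity of `φ`, and the general one in
`HasDenominators.inf` is deduced from it. -/
theorem HasDenominators.inf_denominators (h : HasDenominators φ) {J : Submodule Rᵐᵒᵖ R}
    (hJ : GeneratesUnit φ J) (s : S) : GeneratesUnit φ (J ⊓ denominators φ s) :=
  hJ.trans fun r hr => ⟨_, h (s * φ r), fun d hd =>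
    ⟨J.smul_mem (op d) hr, by
      obtain ⟨a, ha⟩ := mem_denominators.1 hd
      exact ⟨a, by rw [ha, map_mul, mul_assoc]⟩⟩⟩

/-- Clearing denominators in an element `x` of `J S`. Quantifying over `K` lets the induction shrink
`D` summand by summand, so that no intersection of two independent right ideals is needed. -/
theorem HasDenominators.exists_of_mem_span (h : HasDenominators φ) {J : Submodule Rᵐᵒᵖ R} {x : S}
    (hx : x ∈ Submodule.span Sᵐᵒᵖ (φ '' (J : Set R))) :
    ∀ K, GeneratesUnit φ K → ∃ D ≤ K, GeneratesUnit φ D ∧ ∀ d ∈ D, ∃ c ∈ J, φ c = x * φ d := by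
  induction hx using Submodule.closure_induction with
  | zero => exact fun K hK => ⟨K, le_rfl, hK, fun d _ => ⟨0, J.zero_mem, by simp⟩⟩
  | add x y _ _ hx hy =>
    intro K hK
    obtain ⟨D, hDK, hD, hxD⟩ := hx K hK
    obtain ⟨E, hED, hE, hyE⟩ := hy D hD
    refine ⟨E, hED.trans hDK, hE, fun d hd => ?_⟩
    obtain ⟨a, ha, ea⟩ := hxD d (hED hd)
    obtain ⟨b, hb, eb⟩ := hyE d hd
    exact ⟨a + b, J.add_mem ha hb, by rw [map_add, ea, eb, add_mul]⟩
  | smul_mem s x hx =>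
    obtain ⟨j, hj, rfl⟩ := hx
    intro K hK
    refine ⟨_, inf_le_left, h.inf_denominators hK s.unop, fun d hd => ?_⟩
    obtain ⟨a, ha⟩ := mem_denominators.1 hd.2
    refine ⟨j * a, J.smul_mem (op a) hj, ?_⟩
    rw [map_mul, ha, ← mul_assoc]
    rfl

/-- For `r ∈ K` the element `φ r` lies in `S = J S`, so `r D ⊆ J` for some `D` generating the unit
ideal. Injectivity brings this inclusion back from `S` to `R`. -/
theorem HasDenominators.inf (h : HasDenominators φ) (hφ : Function.Injective φ)
    {J K : Submodule Rᵐᵒᵖ R} (hJ : GeneratesUnit φ J) (hK : GeneratesUnit φ K) :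
    GeneratesUnit φ (J ⊓ K) :=
  hK.trans fun r hr => by
    obtain ⟨D, -, hD, hrD⟩ := h.exists_of_mem_span (hJ.mem_span (φ r)) ⊤ .top
    refine ⟨D, hD, fun d hd => ⟨?_, K.smul_mem (op d) hr⟩⟩
    obtain ⟨c, hc, e⟩ := hrD d hd
    rw [← map_mul] at e
    exact hφ e ▸ hc

/-- The elements `x` of `S` all of whose multiples `x * φ a` have enough denominators. -/
def fractions (φ : R →+* S) : Subring S where
  carrier := {x | ∀ a, GeneratesUnit φ (denominators φ (x * φ a))}
  zero_mem' a := GeneratesUnit.top.mono fun r _ => ⟨0, by simp⟩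
  one_mem' a := GeneratesUnit.top.mono fun r _ => ⟨a * r, by simp⟩
  neg_mem' {x} hx a := (hx a).mono fun r ⟨c, hc⟩ => ⟨-c, by simp [hc]⟩
  -- Here `φ c = y * φ a * φ r`. Choosing `d` as a denominator of `x * φ (a * r)` makes `r * d` a
  -- common denominator of `x * φ a` and `y * φ a`.
  add_mem' {x y} hx hy a := (hy a).trans fun r ⟨c, hc⟩ => ⟨_, hx (a * r), fun d ⟨e, he⟩ =>
    ⟨e + c * d, by
      rw [map_add, map_mul, he, hc]
      simp only [map_mul, add_mul, mul_assoc]⟩⟩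
  -- Since `x * y * φ a * φ r = x * φ c`, the hypothesis on `x` is needed at the multiple `x * φ c`;
  -- this is why the definition quantifies over all `a`.
  mul_mem' {x y} hx hy a := (hy a).trans fun r ⟨c, hc⟩ => ⟨_, hx c, fun d ⟨e, he⟩ =>
    ⟨e, by rw [he, hc]; simp only [map_mul, mul_assoc]⟩⟩

theorem mem_fractions {x : S} :
    x ∈ fractions φ ↔ ∀ a, GeneratesUnit φ (denominators φ (x * φ a)) := Iff.rfl

theorem hasDenominators_of_fractions_eq_top (h : fractions φ = ⊤) : HasDenominators φ := fun s => by
  have : s ∈ fractions φ := h ▸ Subring.mem_top s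
  simpa using mem_fractions.1 this 1

theorem HasDenominators.mem_fractions_comp {T : Type u} [Ring T] (i : S →+* T)
    (h : HasDenominators φ) (s : S) : i s ∈ fractions (i.comp φ) := fun a =>
  ((h (s * φ a)).comp i).mono fun r ⟨c, hc⟩ => ⟨c, by simp [hc]⟩

end Denominators

/-! ## Epimorphisms of rings -/

section Epi

variable {R S : Type u} [Ring R] [Ring S] {φ : R →+* S}

theorem epi_ofHom_iff : CategoryTheory.Epi (RingCat.ofHom φ) ↔
    ∀ (X : Type u) [Ring X] (α β : S →+* X), α.comp φ = β.comp φ → α = β := by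
  constructor
  · intro h X _ α β e
    have := (CategoryTheory.cancel_epi (RingCat.ofHom φ) (g := RingCat.ofHom α)
      (h := RingCat.ofHom β)).1 (RingCat.hom_ext e)
    exact congrArg RingCat.Hom.hom this
  · exact fun h => ⟨fun α β e => RingCat.hom_ext (h _ _ _ (congrArg RingCat.Hom.hom e))⟩

/-- Restriction of scalars along an epimorphism of rings is full. -/
theorem map_smul_of_epi (h : CategoryTheory.Epi (RingCat.ofHom φ)) {X Y : Type u} [AddCommGroup X]
    [Module S X] [AddCommGroup Y] (ρ : S →+* AddMonoid.End Y) (g : X →+ Y)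
    (hg : ∀ r x, g (φ r • x) = ρ (φ r) (g x)) (s : S) (x : X) : g (s • x) = ρ s (g x) := by
  let diag : S →+* AddMonoid.End (X × Y) :=
    { toFun := fun s => AddMonoidHom.prodMap (DistribSMul.toAddMonoidHom X s) (ρ s)
      map_one' := AddMonoidHom.ext fun p => Prod.ext (one_smul S p.1)
        (DFunLike.congr_fun (map_one ρ) p.2)
      map_mul' := fun a b => AddMonoidHom.ext fun p => Prod.ext (mul_smul a b p.1)
        (DFunLike.congr_fun (map_mul ρ a b) p.2)
      map_zero' := AddMonoidHom.ext fun p => Prod.ext (zero_smul S p.1)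
        (DFunLike.congr_fun (map_zero ρ) p.2)
      map_add' := fun a b => AddMonoidHom.ext fun p => Prod.ext (add_smul a b p.1)
        (DFunLike.congr_fun (map_add ρ a b) p.2) }
  -- Conjugating the diagonal action on `X × Y` by the shear `(x, y) ↦ (x, y + g x)` gives a second
  -- action of `S`. The two agree on `R` because `g` is `R`-linear, hence on `S`; comparing them at
  -- `(x, 0)` gives `S`-linearity of `g`.
  let shear (g : X →+ Y) : AddMonoid.End (X × Y) :=
    (AddMonoidHom.fst X Y).prod (AddMonoidHom.snd X Y + g.comp (AddMonoidHom.fst X Y))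
  have hshear : shear (-g) * shear g = 1 := AddMonoidHom.ext fun p =>
    Prod.ext rfl (add_neg_cancel_right p.2 (g p.1))
  let conj : S →+* AddMonoid.End (X × Y) :=
    { toFun := fun s => shear g * diag s * shear (-g)
      map_one' := by
        rw [map_one, mul_one]
        exact AddMonoidHom.ext fun p => Prod.ext rfl (neg_add_cancel_right p.2 (g p.1))
      map_mul' := fun a b => by
        rw [map_mul]
        calc shear g * (diag a * diag b) * shear (-g)
            = shear g * diag a * 1 * diag b * shear (-g) := by simp only [mul_assoc, mul_one]
          _ = _ := by rw [← hshear]; simp only [mul_assoc]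
      map_zero' := by simp
      map_add' := fun a b => by rw [map_add, mul_add, add_mul] }
  have := epi_ofHom_iff.1 h _ diag conj (by
    refine RingHom.ext fun r => AddMonoidHom.ext fun p => Prod.ext rfl ?_
    change ρ (φ r) p.2 = ρ (φ r) (p.2 + -g p.1) + g (φ r • p.1)
    rw [hg, map_add, map_neg, neg_add_cancel_right])
  have := congrArg (fun f => (f s (x, 0)).2) this
  change ρ s 0 = ρ s (0 + -g x) + g (s • x) at this
  rw [zero_add, map_neg, map_zero] at this
  exact (neg_add_eq_zero.1 this.symm).symm

end Epi

/-! ## Balanced tensor products -/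

namespace BalancedTensor

section Basic

variable {A : Type u} [Ring A]
variable {N N' : Type v} [AddCommGroup N] [Module Aᵐᵒᵖ N] [AddCommGroup N'] [Module Aᵐᵒᵖ N']
variable {B B' : Type w} [AddCommGroup B] [Module A B] [AddCommGroup B'] [Module A B']

variable (A) in
/-- The class of a pure tensor. -/
def tmul (n : N) (b : B) : BalancedTensor A N B := QuotientAddGroup.mk (n ⊗ₜ[ℤ] b)

theorem smul_tmul (n : N) (a : A) (b : B) : tmul A (op a • n) b = tmul A n (a • b) :=
  (QuotientAddGroup.eq_iff_sub_mem).2 (AddSubgroup.subset_closure ⟨n, a, b, rfl⟩)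

theorem add_tmul (n m : N) (b : B) : tmul A (n + m) b = tmul A n b + tmul A m b :=
  congrArg QuotientAddGroup.mk (TensorProduct.add_tmul n m b)

theorem tmul_add (n : N) (b c : B) : tmul A n (b + c) = tmul A n b + tmul A n c :=
  congrArg QuotientAddGroup.mk (TensorProduct.tmul_add n b c)

theorem zero_tmul (b : B) : tmul A (0 : N) b = 0 :=
  congrArg QuotientAddGroup.mk (TensorProduct.zero_tmul N b)

theorem tmul_zero (n : N) : tmul A n (0 : B) = 0 :=
  congrArg QuotientAddGroup.mk (TensorProduct.tmul_zero B n)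

theorem map_tmul (f : N →ₗ[Aᵐᵒᵖ] N') (g : B →ₗ[A] B') (n : N) (b : B) :
    map f g (tmul A n b) = tmul A (f n) (g b) := rfl

protected theorem induction {p : BalancedTensor A N B → Prop} (tmul : ∀ n b, p (tmul A n b))
    (add : ∀ x y, p x → p y → p (x + y)) (x : BalancedTensor A N B) : p x := by
  obtain ⟨t, rfl⟩ := QuotientAddGroup.mk_surjective x
  induction t with
  | zero =>
    have := tmul 0 0
    rw [zero_tmul] at this
    exact this
  | tmul n b => exact tmul n b
  | add a b ha hb => exact add _ _ ha hb

theorem hom_ext {G : Type*} [AddCommGroup G] {f g : BalancedTensor A N B →+ G}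
    (h : ∀ n b, f (tmul A n b) = g (tmul A n b)) : f = g :=
  AddMonoidHom.ext fun x => BalancedTensor.induction (p := fun x => f x = g x) h
    (fun x y hx hy => by rw [map_add, map_add, hx, hy]) x

/-- The homomorphism induced by a balanced biadditive map. -/
def lift {G : Type*} [AddCommGroup G] (h : N →+ B →+ G)
    (hb : ∀ n (a : A) b, h (op a • n) b = h n (a • b)) : BalancedTensor A N B →+ G :=
  QuotientAddGroup.lift _ (TensorProduct.liftAddHom h fun r n b => by simp) <| by
    rw [balancedRel, AddSubgroup.closure_le]
    rintro _ ⟨n, a, b, rfl⟩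
    change TensorProduct.liftAddHom h _ _ = 0
    rw [map_sub, TensorProduct.liftAddHom_tmul, TensorProduct.liftAddHom_tmul, hb, sub_self]

variable (A N) in
/-- Tensoring with `N` is functorial in the second factor. -/
def mapRight : Module.End A B →+* AddMonoid.End (BalancedTensor A N B) where
  toFun g := map LinearMap.id g
  map_one' := hom_ext fun _ _ => rfl
  map_mul' _ _ := hom_ext fun _ _ => rfl
  map_zero' := hom_ext fun n _ => tmul_zero n
  map_add' _ _ := hom_ext fun n _ => tmul_add n _ _

variable (A B) in
/-- Tensoring with `B` is functorial in the first factor. -/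
def mapLeft : Module.End Aᵐᵒᵖ N →+* AddMonoid.End (BalancedTensor A N B) where
  toFun g := map g LinearMap.id
  map_one' := hom_ext fun _ _ => rfl
  map_mul' _ _ := hom_ext fun _ _ => rfl
  map_zero' := hom_ext fun _ b => zero_tmul b
  map_add' _ _ := hom_ext fun _ b => add_tmul _ _ b

end Basic

section Swap

variable {A : Type u} [Ring A] [StarRing A]
variable {N N₁ : Type v} [AddCommGroup N] [Module Aᵐᵒᵖ N] [AddCommGroup N₁] [Module A N₁]
variable {B B₁ : Type w} [AddCommGroup B] [Module A B] [AddCommGroup B₁] [Module Aᵐᵒᵖ B₁]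

/-- Over a ring with involution the factors of a tensor product can be interchanged, the sides of
the modules being switched by means of the involution. -/
def swap (f : N →+ N₁) (g : B →+ B₁) (hf : ∀ (a : A) n, f (op a • n) = star a • f n)
    (hg : ∀ (a : A) b, g (a • b) = op (star a) • g b) :
    BalancedTensor A N B →+ BalancedTensor A B₁ N₁ :=
  lift
    { toFun := fun n =>
        { toFun := fun b => tmul A (g b) (f n)
          map_zero' := by rw [map_zero, zero_tmul]
          map_add' := fun b c => by rw [map_add, add_tmul] }
      map_zero' := AddMonoidHom.ext fun b => by simp [tmul_zero]
      map_add' := fun n m => AddMonoidHom.ext fun b => by simp [tmul_add] }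
    fun n a b => by
      change tmul A (g b) (f (op a • n)) = tmul A (g (a • b)) (f n)
      rw [hf, hg, smul_tmul]

end Swap

end BalancedTensor

/-! ## The elementwise description of perfect right rings of quotients -/

section Perfect

variable {R S : Type u} [Ring R] [Ring S] {φ : R →+* S}

/-- If `α` and `β` agree on `R` and `s * φ r` is in `R`, then `α s * β (φ r) = β s * β (φ r)`. The
denominators `r` of `s` generate the unit ideal, so the factor `β (φ r)` can be replaced by `1`. -/
theorem epi_of_hasDenominators (h : HasDenominators φ) :
    CategoryTheory.Epi (RingCat.ofHom φ) := by
  refine epi_ofHom_iff.2 fun X _ α β e => RingHom.ext fun s => ?_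
  have e' : ∀ r, α (φ r) = β (φ r) := fun r => RingHom.congr_fun e r
  have key : ∀ x ∈ Submodule.span Sᵐᵒᵖ (φ '' (denominators φ s : Set R)),
      α s * β x = β s * β x := by
    intro x hx
    induction hx using Submodule.span_induction with
    | mem x hx =>
      obtain ⟨r, hr, rfl⟩ := hx
      obtain ⟨a, ha⟩ := mem_denominators.1 hr
      rw [← e', ← map_mul, ← ha, e', ha, map_mul, e']
    | zero => simp
    | add x y _ _ hx hy => rw [map_add, mul_add, mul_add, hx, hy]
    | smul c x _ hx =>
      rw [show c • x = x * c.unop from rfl, map_mul, ← mul_assoc, ← mul_assoc, hx]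
  simpa using key 1 (h s)

/-- If `S` is an epimorphic extension of `R`, then `s ⊗ 1 = 1 ⊗ s` in `S ⊗_R S`. -/
theorem tmul_one_eq_one_tmul [Module R S] [Module Rᵐᵒᵖ S] (hl : ∀ (r : R) (s : S), r • s = φ r * s)
    (hr : ∀ (r : R) (s : S), op r • s = s * φ r) (h : CategoryTheory.Epi (RingCat.ofHom φ))
    (s : S) : BalancedTensor.tmul R s (1 : S) = BalancedTensor.tmul R (1 : S) s := by
  let L : S →+* Module.End Rᵐᵒᵖ S :=
    { toFun := fun s =>
        { toFun := fun x => s * x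
          map_add' := mul_add s
          map_smul' := fun c x => by
            change s * (op c.unop • x) = op c.unop • (s * x)
            rw [hr, hr, mul_assoc] }
      map_one' := LinearMap.ext one_mul
      map_mul' := fun a b => LinearMap.ext (mul_assoc a b)
      map_zero' := LinearMap.ext zero_mul
      map_add' := fun a b => LinearMap.ext (add_mul a b) }
  -- The map `x ↦ 1 ⊗ x` is `R`-linear for the action on the left factor, since `1 ⊗ r x = r ⊗ x`.
  -- By fullness it is `S`-linear; evaluate at `x = 1`.
  let g : S →+ BalancedTensor R S S :=
    { toFun := fun s => BalancedTensor.tmul R 1 s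
      map_zero' := BalancedTensor.tmul_zero _
      map_add' := BalancedTensor.tmul_add _ }
  have := map_smul_of_epi h ((BalancedTensor.mapLeft R S).comp L) g (fun r x => by
    change BalancedTensor.tmul R 1 (φ r * x) = BalancedTensor.tmul R (φ r * 1) x
    rw [← hl, ← BalancedTensor.smul_tmul, hr, mul_one, one_mul]) s 1
  change BalancedTensor.tmul R 1 (s * 1) = BalancedTensor.tmul R (s * 1) 1 at this
  rw [mul_one] at this
  exact this.symm

/-- Left multiplication by `s` embeds `R / D` into `S / R`, where `D` is the right ideal of
denominators of `s`. By flatness `(R / D) ⊗ S` embeds into `(S / R) ⊗ S`, where the image of `1 ⊗ 1`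
is `s ⊗ 1 = 1 ⊗ s = 0`. Hence `1 ⊗ 1 = 0` in `(R / D) ⊗ S`, which maps to `S / D S`, so `1 ∈ D S`.
-/
theorem IsPerfectRight.hasDenominators (h : IsPerfectRight φ) : HasDenominators φ := by
  intro s
  obtain ⟨hepi, hflat⟩ := h
  let _ : Module R S := Module.compHom S φ
  let _ : Module Rᵐᵒᵖ S := Module.compHom S φ.op
  have hl : ∀ (r : R) (s : S), r • s = φ r * s := fun _ _ => rfl
  have hr : ∀ (r : R) (s : S), op r • s = s * φ r := fun _ _ => rfl
  let D := denominators φ s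
  let φl : R →ₗ[Rᵐᵒᵖ] S :=
    { toFun := φ
      map_add' := map_add φ
      map_smul' := fun c r => map_mul φ r c.unop }
  let sl : R →ₗ[Rᵐᵒᵖ] S :=
    { toFun := fun r => s * φ r
      map_add' := fun a b => by rw [map_add, mul_add]
      map_smul' := fun c r => by
        rw [show c • r = r * c.unop from rfl, map_mul, ← mul_assoc]; rfl }
  let P : Submodule Rᵐᵒᵖ S := LinearMap.range φl
  let f : (R ⧸ D) →ₗ[Rᵐᵒᵖ] S ⧸ P := D.mapQ P sl fun r hr => hr
  have hf : Function.Injective f := by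
    rw [← LinearMap.ker_eq_bot, LinearMap.ker_eq_bot']
    intro x hx
    obtain ⟨r, rfl⟩ := D.mkQ_surjective x
    exact (Submodule.Quotient.mk_eq_zero D).2 ((Submodule.Quotient.mk_eq_zero P).1 hx)
  have h0 : BalancedTensor.tmul R (D.mkQ 1) (1 : S) = 0 := by
    apply hflat _ _ f hf
    rw [map_zero]
    change BalancedTensor.tmul R (P.mkQ (s * φ 1)) (1 : S) = 0
    rw [map_one, mul_one]
    have := congrArg (BalancedTensor.map P.mkQ (LinearMap.id : S →ₗ[R] S))
      (tmul_one_eq_one_tmul hl hr hepi s)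
    rw [BalancedTensor.map_tmul, BalancedTensor.map_tmul] at this
    refine this.trans ?_
    rw [show P.mkQ 1 = 0 from (Submodule.Quotient.mk_eq_zero P).2 ⟨1, map_one φ⟩,
      BalancedTensor.zero_tmul]
  let E := (Submodule.span Sᵐᵒᵖ (φ '' (D : Set R))).toAddSubgroup
  let μ : R →+ S →+ S ⧸ E :=
    AddMonoidHom.compl₂ ((AddMonoidHom.compHom (QuotientAddGroup.mk' E)).comp
      (AddMonoidHom.mul.comp φ.toAddMonoidHom)) (AddMonoidHom.id S)
  let ν : (R ⧸ D) →+ S →+ S ⧸ E := QuotientAddGroup.lift D.toAddSubgroup μ fun d hd =>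
    AddMonoidHom.ext fun x => (QuotientAddGroup.eq_zero_iff _).2
      (Submodule.smul_mem _ (op x) (Submodule.subset_span ⟨d, hd, rfl⟩))
  have h1 := congrArg (BalancedTensor.lift ν fun n a b => by
    obtain ⟨r, rfl⟩ := D.mkQ_surjective n
    change QuotientAddGroup.mk (φ (r * a) * b) = QuotientAddGroup.mk (φ r * (φ a * b))
    rw [map_mul, mul_assoc]) h0
  rw [map_zero] at h1
  have h2 : φ 1 * 1 ∈ E := (QuotientAddGroup.eq_zero_iff _).1 h1
  rw [map_one, mul_one] at h2
  exact h2

/-- The kernel of `N → N ⊗_R S` consists of elements that are annihilated by a right ideal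
generating the unit ideal. -/
theorem HasDenominators.exists_annihilator [Module R S] (hl : ∀ (r : R) (s : S), r • s = φ r * s)
    (h : HasDenominators φ) (hφ : Function.Injective φ) {N : Type u} [AddCommGroup N]
    [Module Rᵐᵒᵖ N] {n : N} (hn : BalancedTensor.tmul R n (1 : S) = 0) :
    ∃ D : Submodule Rᵐᵒᵖ R, GeneratesUnit φ D ∧ ∀ d ∈ D, op d • n = 0 := by
  classical
  -- The quotient `(R → N) ⧸ K` consists of germs of functions along the right ideals generating the
  -- unit ideal. The balanced map `n ⊗ s ↦ (r ↦ n (s r))` into it sends `n ⊗ 1` to the germ of `r ↦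
  -- n r`.
  let K : AddSubgroup (R → N) :=
    { carrier := {k | ∃ D : Submodule Rᵐᵒᵖ R, GeneratesUnit φ D ∧ ∀ d ∈ D, k d = 0}
      zero_mem' := ⟨⊤, .top, fun _ _ => rfl⟩
      add_mem' := by
        rintro k l ⟨D, hD, hk⟩ ⟨E, hE, hl⟩
        refine ⟨D ⊓ E, h.inf hφ hD hE, fun d hd => ?_⟩
        rw [Pi.add_apply, hk d hd.1, hl d hd.2, add_zero]
      neg_mem' := by
        rintro k ⟨D, hD, hk⟩
        exact ⟨D, hD, fun d hd => by rw [Pi.neg_apply, hk d hd, neg_zero]⟩ }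
  -- The value `0` off the denominators of `s` is irrelevant modulo `K`.
  let ev (n : N) (s : S) (r : R) : N := if hr : r ∈ denominators φ s then op hr.choose • n else 0
  have hev : ∀ n s r a, φ a = s * φ r → ev n s r = op a • n := by
    intro n s r a ha
    have hr : r ∈ denominators φ s := ⟨a, ha⟩
    have : hr.choose = a := hφ (hr.choose_spec.trans ha.symm)
    rw [show ev n s r = op hr.choose • n from dif_pos hr, this]
  let ε : N →+ S →+ (R → N) ⧸ K :=
    { toFun := fun n =>
        { toFun := fun s => QuotientAddGroup.mk (ev n s)
          map_zero' := (QuotientAddGroup.eq_zero_iff _).2 ⟨⊤, .top, fun r _ => by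
            rw [hev n 0 r 0 (by simp), op_zero, zero_smul]⟩
          map_add' := fun s t => by
            rw [← QuotientAddGroup.mk_add, QuotientAddGroup.eq_iff_sub_mem]
            refine ⟨_, h.inf_denominators (h s) t, fun d ⟨⟨a, ha⟩, ⟨b, hb⟩⟩ => ?_⟩
            change φ a = _ at ha
            change φ b = _ at hb
            rw [Pi.sub_apply, Pi.add_apply, hev n s d a ha, hev n t d b hb,
              hev n (s + t) d (a + b) (by rw [map_add, ha, hb, add_mul]), op_add, add_smul,
              sub_self] }
      map_zero' := AddMonoidHom.ext fun s => by
        refine (QuotientAddGroup.eq_zero_iff _).2 ⟨_, h s, fun d ⟨a, ha⟩ => ?_⟩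
        rw [hev 0 s d a ha, smul_zero]
      map_add' := fun n m => AddMonoidHom.ext fun s => by
        change QuotientAddGroup.mk (ev (n + m) s) =
          QuotientAddGroup.mk (ev n s) + QuotientAddGroup.mk (ev m s)
        rw [← QuotientAddGroup.mk_add, QuotientAddGroup.eq_iff_sub_mem]
        refine ⟨_, h s, fun d ⟨a, ha⟩ => ?_⟩
        change φ a = _ at ha
        rw [Pi.sub_apply, Pi.add_apply, hev _ s d a ha, hev _ s d a ha, hev _ s d a ha, smul_add,
          sub_self] }
  have h0 := congrArg (BalancedTensor.lift ε fun n a s => by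
    change (QuotientAddGroup.mk (ev (op a • n) s) : (R → N) ⧸ K) =
      QuotientAddGroup.mk (ev n (a • s))
    rw [QuotientAddGroup.eq_iff_sub_mem]
    refine ⟨_, h s, fun d ⟨b, hb⟩ => ?_⟩
    change φ b = _ at hb
    rw [Pi.sub_apply, hev _ s d b hb,
      hev n (a • s) d (a * b) (by rw [map_mul, hb, hl, mul_assoc]), op_mul, mul_smul, sub_self]) hn
  rw [map_zero] at h0
  obtain ⟨D, hD, hDn⟩ := (QuotientAddGroup.eq_zero_iff _).1 h0
  refine ⟨D, hD, fun d hd => ?_⟩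
  rw [← hev n 1 d d (one_mul _).symm]
  exact hDn d hd

/-- Right multiplication by suitable denominators turns any `x` in `N ⊗ S` into elements `m ⊗ 1`. If
`x` maps to `0`, then `f m ⊗ 1 = 0`, so `f m`, and by injectivity `m`, is annihilated by a right
ideal generating the unit ideal. Such right ideals detect zero in `N ⊗ S`, which is the content of
`key`, used twice. -/
theorem HasDenominators.flat [Module R S] (hl : ∀ (r : R) (s : S), r • s = φ r * s)
    (h : HasDenominators φ) (hφ : Function.Injective φ) : FlatLeftModule R S := by
  intro N N' _ _ _ _ f hf
  let ρ : S → Module.End R S := fun s =>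
    { toFun := fun x => x * s
      map_add' := fun x y => add_mul x y s
      map_smul' := fun r x => by rw [hl, mul_assoc, RingHom.id_apply, hl] }
  have hρ_one : ρ 1 = 1 := LinearMap.ext mul_one
  have hρ_add : ∀ s t, ρ (s + t) = ρ s + ρ t := fun s t => LinearMap.ext fun x => mul_add x s t
  have hρ_mul : ∀ s t, ρ (s * t) = ρ t * ρ s := fun s t => LinearMap.ext fun x =>
    (mul_assoc x s t).symm
  have hρ_zero : ρ 0 = 0 := LinearMap.ext fun x => mul_zero x
  have key : ∀ {D : Submodule Rᵐᵒᵖ R}, GeneratesUnit φ D → ∀ x : BalancedTensor R N S,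
      (∀ d ∈ D, BalancedTensor.mapRight R N (ρ (φ d)) x = 0) → x = 0 := by
    intro D hD x hx
    have : ∀ s ∈ Submodule.span Sᵐᵒᵖ (φ '' (D : Set R)),
        BalancedTensor.mapRight R N (ρ s) x = 0 := by
      intro s hs
      induction hs using Submodule.span_induction with
      | mem s hs =>
        obtain ⟨d, hd, rfl⟩ := hs
        exact hx d hd
      | zero => rw [hρ_zero, map_zero]; rfl
      | add s t _ _ hs ht =>
        rw [hρ_add, map_add]
        change BalancedTensor.mapRight R N (ρ s) x + BalancedTensor.mapRight R N (ρ t) x = 0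
        rw [hs, ht, add_zero]
      | smul c s _ hs =>
        rw [show c • s = s * c.unop from rfl, hρ_mul, map_mul]
        change BalancedTensor.mapRight R N (ρ c.unop) (BalancedTensor.mapRight R N (ρ s) x) = 0
        rw [hs, map_zero]
    have := this 1 hD
    rwa [hρ_one, map_one] at this
  have denom : ∀ x : BalancedTensor R N S, ∃ D, GeneratesUnit φ D ∧ ∀ d ∈ D,
      ∃ m : N, BalancedTensor.mapRight R N (ρ (φ d)) x = BalancedTensor.tmul R m (1 : S) := by
    intro x
    induction x using BalancedTensor.induction with
    | tmul n s =>
      refine ⟨_, h s, fun d ⟨a, ha⟩ => ⟨op a • n, ?_⟩⟩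
      change φ a = _ at ha
      change BalancedTensor.tmul R n (s * φ d) = _
      rw [BalancedTensor.smul_tmul, hl, mul_one, ha]
    | add x y hx hy =>
      obtain ⟨D, hD, hx⟩ := hx
      obtain ⟨E, hE, hy⟩ := hy
      refine ⟨_, h.inf hφ hD hE, fun d hd => ?_⟩
      obtain ⟨m, hm⟩ := hx d hd.1
      obtain ⟨k, hk⟩ := hy d hd.2
      exact ⟨m + k, by rw [map_add, hm, hk, BalancedTensor.add_tmul]⟩
  rw [injective_iff_map_eq_zero]
  intro x hx
  obtain ⟨D, hD, hDx⟩ := denom x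
  refine key hD x fun d hd => ?_
  obtain ⟨m, hm⟩ := hDx d hd
  rw [hm]
  have hfm : BalancedTensor.tmul R (f m) (1 : S) = 0 := by
    have e : (BalancedTensor.map f (LinearMap.id : S →ₗ[R] S)).comp
          (BalancedTensor.mapRight R N (ρ (φ d))) =
        (BalancedTensor.mapRight R N' (ρ (φ d))).comp (BalancedTensor.map f LinearMap.id) :=
      BalancedTensor.hom_ext fun _ _ => rfl
    have e' := DFunLike.congr_fun e x
    change BalancedTensor.map f LinearMap.id (BalancedTensor.mapRight R N (ρ (φ d)) x) =
      BalancedTensor.mapRight R N' (ρ (φ d)) (BalancedTensor.map f LinearMap.id x) at e'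
    rw [hx, map_zero, hm, BalancedTensor.map_tmul] at e'
    exact e'
  obtain ⟨E, hE, hEm⟩ := h.exists_annihilator hl hφ hfm
  refine key hE _ fun e he => ?_
  change BalancedTensor.tmul R m (1 * φ e) = 0
  have : op e • m = 0 := hf (by rw [map_smul, hEm e he, map_zero])
  rw [one_mul, ← mul_one (φ e), ← hl, ← BalancedTensor.smul_tmul, this, BalancedTensor.zero_tmul]

theorem isPerfectRight_iff_hasDenominators (hφ : Function.Injective φ) :
    IsPerfectRight φ ↔ HasDenominators φ :=
  ⟨fun h => h.hasDenominators, fun h => ⟨epi_of_hasDenominators h,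
    letI : Module R S := Module.compHom S φ
    h.flat (fun _ _ => rfl) hφ⟩⟩

/-- The subring generated by perfect right rings of quotients of `R` inside an extension of `R` is
a perfect right ring of quotients. -/
theorem isPerfectRight_sSup {Q : Type u} [Ring Q] (ι : R →+* Q) (hι : Function.Injective ι)
    (h : ∀ r, ι r ∈ sSup {S : Subring Q | ∃ h : ∀ r, ι r ∈ S, IsPerfectRight (ι.codRestrict S h)}) :
    IsPerfectRight (ι.codRestrict _ h) := by
  set T := sSup {S : Subring Q | ∃ h : ∀ r, ι r ∈ S, IsPerfectRight (ι.codRestrict S h)} with hT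
  have inj : Function.Injective (ι.codRestrict T h) := fun _ _ e => hι (congrArg Subtype.val e)
  rw [isPerfectRight_iff_hasDenominators inj]
  apply hasDenominators_of_fractions_eq_top
  -- It suffices to treat the generating rings `S`, because `fractions` is a subring; denominators
  -- found in `S` remain valid in `T`.
  have hle : T ≤ (fractions (ι.codRestrict T h)).map T.subtype := by
    conv_lhs => rw [hT]
    refine sSup_le ?_
    rintro S ⟨hS, hp⟩ x hx
    have hST : S ≤ T := le_sSup ⟨hS, hp⟩
    exact ⟨_, hp.hasDenominators.mem_fractions_comp (Subring.inclusion hST) ⟨x, hx⟩, rfl⟩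
  refine eq_top_iff.2 fun x _ => ?_
  obtain ⟨y, hy, e⟩ := hle x.2
  rwa [← Subtype.ext (a1 := y) (a2 := x) e]

end Perfect

/-! ## Interchanging left and right by an involution -/

section Transfer

variable {R S T : Type u} [Ring R] [StarRing R] [Ring S] [Ring T] {φ : R →+* S} {ψ : R →+* T}

/-- Two maps `T → X` are tested as maps `S → Tᵐᵒᵖ → Xᵐᵒᵖ`. -/
theorem epi_of_anti (σ : S ≃+* Tᵐᵒᵖ) (hσ : ∀ r, σ (φ r) = op (ψ (star r)))
    (h : CategoryTheory.Epi (RingCat.ofHom φ)) : CategoryTheory.Epi (RingCat.ofHom ψ) := by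
  refine epi_ofHom_iff.2 fun X _ α β e => RingHom.ext fun t => ?_
  have := epi_ofHom_iff.1 h Xᵐᵒᵖ (α.op.comp σ) (β.op.comp σ) (RingHom.ext fun r => by
    simpa [hσ] using RingHom.congr_fun e (star r))
  simpa using RingHom.congr_fun this (σ.symm (op t))

/-- A right module `N` becomes a left module through `a • n = n a*`, and then `N ⊗ T` is naturally
identified with `S ⊗ N`, so flatness changes sides. -/
theorem IsPerfectLeft.anti (σ : S ≃+* Tᵐᵒᵖ) (hσ : ∀ r, σ (φ r) = op (ψ (star r)))
    (h : IsPerfectLeft φ) : IsPerfectRight ψ := by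
  refine ⟨epi_of_anti σ hσ h.1, ?_⟩
  let _ : Module R T := Module.compHom T ψ
  let _ : Module Rᵐᵒᵖ S := Module.compHom S φ.op
  have hflat : FlatRightModule R S := h.2
  intro N N' _ _ _ _ f hf
  let st : R →+* Rᵐᵒᵖ := (starRingEquiv : R ≃+* Rᵐᵒᵖ)
  let _ : Module R N := Module.compHom N st
  let _ : Module R N' := Module.compHom N' st
  let τ : S →+ T := (opAddEquiv.symm : Tᵐᵒᵖ ≃+ T).toAddMonoidHom.comp σ.toAddEquiv.toAddMonoidHom
  let τ' : T →+ S :=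
    σ.symm.toAddEquiv.toAddMonoidHom.comp (opAddEquiv : T ≃+ Tᵐᵒᵖ).toAddMonoidHom
  have hτ : ∀ (a : R) (s : S), τ (op a • s) = star a • τ s := fun a s => by
    change (σ (s * φ a)).unop = ψ (star a) * (σ s).unop
    rw [map_mul, hσ]
    rfl
  have hτ' : ∀ (a : R) (t : T), τ' (a • t) = op (star a) • τ' t := fun a t => by
    change σ.symm (op (ψ a * t)) = σ.symm (op t) * φ (star a)
    rw [RingEquiv.symm_apply_eq, map_mul, hσ, star_star, RingEquiv.apply_symm_apply, op_mul]
  have hN : ∀ (a : R) (n : N), op a • n = star a • n := fun a n => by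
    change op a • n = op (star (star a)) • n
    rw [star_star]
  have hN' : ∀ (a : R) (n : N'), op a • n = star a • n := fun a n => by
    change op a • n = op (star (star a)) • n
    rw [star_star]
  let sw := BalancedTensor.swap (AddMonoidHom.id N) τ' hN hτ'
  let sw' := BalancedTensor.swap (AddMonoidHom.id N') τ' hN' hτ'
  let back := BalancedTensor.swap τ (AddMonoidHom.id N) hτ fun _ _ => rfl
  have hback : ∀ x, back (sw x) = x := DFunLike.congr_fun
    (BalancedTensor.hom_ext (f := back.comp sw) (g := AddMonoidHom.id _) fun n t => by
      change BalancedTensor.tmul R n (σ (σ.symm (op t))).unop = BalancedTensor.tmul R n t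
      rw [RingEquiv.apply_symm_apply, unop_op])
  let g : N →ₗ[R] N' :=
    { toFun := f
      map_add' := map_add f
      map_smul' := fun a n => map_smul f (op (star a)) n }
  have hcomm : (BalancedTensor.map LinearMap.id g).comp sw =
      sw'.comp (BalancedTensor.map f LinearMap.id) := BalancedTensor.hom_ext fun _ _ => rfl
  -- Only injectivity of `sw` is used, so a left inverse `back` is enough.
  refine Function.Injective.of_comp (f := sw') ?_
  rw [← AddMonoidHom.coe_comp, ← hcomm, AddMonoidHom.coe_comp]
  exact (hflat N N' g hf).comp (Function.LeftInverse.injective hback)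

theorem IsPerfectRight.anti (σ : S ≃+* Tᵐᵒᵖ) (hσ : ∀ r, σ (φ r) = op (ψ (star r)))
    (h : IsPerfectRight φ) : IsPerfectLeft ψ := by
  refine ⟨epi_of_anti σ hσ h.1, ?_⟩
  let _ : Module R S := Module.compHom S φ
  let _ : Module Rᵐᵒᵖ T := Module.compHom T ψ.op
  have hflat : FlatLeftModule R S := h.2
  intro N N' _ _ _ _ f hf
  let st : Rᵐᵒᵖ →+* R := (starRingEquiv : R ≃+* Rᵐᵒᵖ).symm
  let _ : Module Rᵐᵒᵖ N := Module.compHom N st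
  let _ : Module Rᵐᵒᵖ N' := Module.compHom N' st
  let τ : S →+ T := (opAddEquiv.symm : Tᵐᵒᵖ ≃+ T).toAddMonoidHom.comp σ.toAddEquiv.toAddMonoidHom
  let τ' : T →+ S :=
    σ.symm.toAddEquiv.toAddMonoidHom.comp (opAddEquiv : T ≃+ Tᵐᵒᵖ).toAddMonoidHom
  have hτ : ∀ (a : R) (s : S), τ (a • s) = op (star a) • τ s := fun a s => by
    change (σ (φ a * s)).unop = (σ s).unop * ψ (star a)
    rw [map_mul, hσ]
    rfl
  have hτ' : ∀ (a : R) (t : T), τ' (op a • t) = star a • τ' t := fun a t => by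
    change σ.symm (op (t * ψ a)) = φ (star a) * σ.symm (op t)
    rw [RingEquiv.symm_apply_eq, map_mul, hσ, star_star, RingEquiv.apply_symm_apply, op_mul]
  have hst : ∀ a : R, st (op (star a)) = a := star_star
  have hN : ∀ (a : R) (n : N), a • n = op (star a) • n := fun a n => by
    change a • n = st (op (star a)) • n
    rw [hst]
  have hN' : ∀ (a : R) (n : N'), a • n = op (star a) • n := fun a n => by
    change a • n = st (op (star a)) • n
    rw [hst]
  let sw := BalancedTensor.swap τ' (AddMonoidHom.id N) hτ' hN
  let sw' := BalancedTensor.swap τ' (AddMonoidHom.id N') hτ' hN'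
  let back := BalancedTensor.swap (AddMonoidHom.id N) τ (fun _ _ => rfl) hτ
  have hback : ∀ x, back (sw x) = x := DFunLike.congr_fun
    (BalancedTensor.hom_ext (f := back.comp sw) (g := AddMonoidHom.id _) fun t n => by
      change BalancedTensor.tmul R (σ (σ.symm (op t))).unop n = BalancedTensor.tmul R t n
      rw [RingEquiv.apply_symm_apply, unop_op])
  let g : N →ₗ[Rᵐᵒᵖ] N' :=
    { toFun := f
      map_add' := map_add f
      map_smul' := fun a n => map_smul f (st a) n }
  have hcomm : (BalancedTensor.map g LinearMap.id).comp sw =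
      sw'.comp (BalancedTensor.map LinearMap.id f) := BalancedTensor.hom_ext fun _ _ => rfl
  refine Function.Injective.of_comp (f := sw') ?_
  rw [← AddMonoidHom.coe_comp, ← hcomm, AddMonoidHom.coe_comp]
  exact (hflat N N' g hf).comp (Function.LeftInverse.injective hback)

/-- The ring homomorphism `r ↦ φ (r*)` into the opposite ring. -/
def starOp (φ : R →+* S) : R →+* Sᵐᵒᵖ := φ.op.comp (starRingEquiv : R ≃+* Rᵐᵒᵖ).toRingHom

theorem starOp_apply (φ : R →+* S) (r : R) : starOp φ r = op (φ (star r)) := rfl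

/-- An isomorphism over `R` factors into two antiisomorphisms over `*`, by way of `Sᵐᵒᵖ` with the
structure map `starOp φ`. -/
theorem IsPerfectRight.congr (e : S ≃+* T) (he : ∀ r, e (φ r) = ψ r) (h : IsPerfectRight φ) :
    IsPerfectRight ψ :=
  IsPerfectLeft.anti (φ := starOp φ) (RingEquiv.op e) (fun r => by simp [starOp_apply, he])
    (h.anti (RingEquiv.opOp S) fun r => by simp [starOp_apply])

theorem IsPerfectLeft.congr (e : S ≃+* T) (he : ∀ r, e (φ r) = ψ r) (h : IsPerfectLeft φ) :
    IsPerfectLeft ψ :=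
  IsPerfectRight.anti (φ := starOp φ) (RingEquiv.op e) (fun r => by simp [starOp_apply, he])
    (h.anti (RingEquiv.opOp S) fun r => by simp [starOp_apply])

/-- The subring corresponding to `A` under an antiisomorphism. -/
def antiSubring (σ : S ≃+* Tᵐᵒᵖ) (A : Subring S) : Subring T :=
  (A.comap (σ.symm : Tᵐᵒᵖ →+* S)).unop

theorem mem_antiSubring {σ : S ≃+* Tᵐᵒᵖ} {A : Subring S} {t : T} :
    t ∈ antiSubring σ A ↔ σ.symm (op t) ∈ A := Iff.rfl

theorem unop_mem_antiSubring {σ : S ≃+* Tᵐᵒᵖ} {A : Subring S} {s : S} :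
    (σ s).unop ∈ antiSubring σ A ↔ s ∈ A := by
  rw [mem_antiSubring, op_unop, RingEquiv.symm_apply_apply]

/-- The restriction of an antiisomorphism to corresponding subrings. -/
def antiRestrict (σ : S ≃+* Tᵐᵒᵖ) (A : Subring S) (B : Subring T)
    (hB : ∀ t, t ∈ B ↔ σ.symm (op t) ∈ A) : A ≃+* Bᵐᵒᵖ where
  toFun a := op ⟨(σ a).unop, (hB _).2 (by simp)⟩
  invFun b := ⟨σ.symm (op b.unop), (hB _).1 b.unop.2⟩
  left_inv a := by simp
  right_inv b := by simp
  map_mul' a b := by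
    apply unop_injective
    apply Subtype.ext
    simp
  map_add' a b := by
    apply unop_injective
    apply Subtype.ext
    simp

end Transfer

/-! ## Transport of partial endomorphisms along semilinear isomorphisms -/

section Transport

variable {A A' : Type u} [Ring A] [Ring A'] {M M' : Type v} [AddCommGroup M] [Module A M]
  [AddCommGroup M'] [Module A' M'] (σ : A ≃+* A') (e : M ≃+ M')

theorem semilinear_symm (he : ∀ a m, e (a • m) = σ a • e m) (a : A') (m : M') :
    e.symm (a • m) = σ.symm a • e.symm m := by
  rw [AddEquiv.symm_apply_eq, he, RingEquiv.apply_symm_apply, AddEquiv.apply_symm_apply]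

/-- The conjugate of a partial endomorphism under a semilinear isomorphism. -/
def transportPMap (he : ∀ a m, e (a • m) = σ a • e m) (f : M →ₗ.[A] M) : M' →ₗ.[A'] M' where
  domain :=
    { carrier := {y | e.symm y ∈ f.domain}
      zero_mem' := by
        change e.symm 0 ∈ f.domain
        rw [map_zero]
        exact zero_mem _
      add_mem' := fun {x y} hx hy => by
        change e.symm (x + y) ∈ f.domain
        rw [map_add]
        exact add_mem hx hy
      smul_mem' := fun c x hx => by
        change e.symm (c • x) ∈ f.domain
        rw [semilinear_symm σ e he]
        exact f.domain.smul_mem _ hx }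
  toFun :=
    { toFun := fun y => e (f ⟨e.symm y.1, y.2⟩)
      map_add' := fun x y => by
        rw [← map_add, ← f.map_add]
        exact congrArg (fun z => e (f z)) (Subtype.ext (map_add e.symm x.1 y.1))
      map_smul' := fun c x => by
        obtain ⟨c, rfl⟩ := σ.surjective c
        rw [RingHom.id_apply, ← he, ← f.map_smul]
        refine congrArg (fun z => e (f z)) (Subtype.ext ?_)
        refine (semilinear_symm σ e he _ _).trans ?_
        rw [RingEquiv.symm_apply_apply]
        rfl }

theorem IsDense.transport (he : ∀ a m, e (a • m) = σ a • e m) {f : M →ₗ.[A] M}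
    (hf : IsDense f.domain) : IsDense (transportPMap σ e he f).domain := fun x y hy => by
  obtain ⟨a, ha, hay⟩ := hf (e.symm x) (e.symm y) fun h =>
    hy ((map_eq_zero_iff _ e.symm.injective).1 h)
  refine ⟨σ a, ?_, fun h => hay ?_⟩
  · change e.symm (σ a • x) ∈ f.domain
    rwa [semilinear_symm σ e he, RingEquiv.symm_apply_apply]
  · have := congrArg e.symm h
    rwa [semilinear_symm σ e he, RingEquiv.symm_apply_apply, map_zero] at this

/-- The map on classes induced by `transportPMap`. -/
def transportDense (he : ∀ a m, e (a • m) = σ a • e m) : DenseEnd A M → DenseEnd A' M' :=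
  Quotient.map (fun f => ⟨transportPMap σ e he f.1, f.2.transport σ e he⟩)
    fun f g ⟨N, hN, h⟩ => by
      -- Restricted to `N`, the map `f` has domain exactly `N`, so the domain of its transport is
      -- the dense submodule on which the two transports agree.
      let fN := f.1.domRestrict N
      have hfN : IsDense fN.domain := by
        rw [show fN.domain = N from inf_eq_left.2 fun x hx => (h x hx).1]
        exact hN
      refine ⟨_, hfN.transport σ e he, fun x hx => ?_⟩
      obtain ⟨hf, hg, e'⟩ := h _ hx.1
      exact ⟨hf, hg, congrArg e e'⟩

/-- A semilinear isomorphism induces an isomorphism of the rings of densely defined partial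
endomorphisms. -/
def transportEquiv (he : ∀ a m, e (a • m) = σ a • e m) : DenseEnd A M ≃+* DenseEnd A' M' where
  toFun := transportDense σ e he
  invFun := transportDense σ.symm e.symm (semilinear_symm σ e he)
  left_inv q := by
    induction q using DenseEnd.ind with | h f =>
    refine DenseEnd.mk_eq_of fun x _ hx => ?_
    change e.symm (e (f.1 ⟨e.symm (e x), _⟩)) = f.1 ⟨x, hx⟩
    rw [AddEquiv.symm_apply_apply]
    exact congrArg f.1 (Subtype.ext (e.symm_apply_apply x))
  right_inv q := by
    induction q using DenseEnd.ind with | h f =>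
    refine DenseEnd.mk_eq_of fun x _ hx => ?_
    change e (e.symm (f.1 ⟨e (e.symm x), _⟩)) = f.1 ⟨x, hx⟩
    rw [AddEquiv.apply_symm_apply]
    exact congrArg f.1 (Subtype.ext (e.apply_symm_apply x))
  map_add' p q := by
    induction p using DenseEnd.ind with | h f =>
    induction q using DenseEnd.ind with | h g =>
    exact DenseEnd.mk_eq_of fun x h₁ h₂ => map_add e (f.1 ⟨_, h₁.1⟩) (g.1 ⟨_, h₁.2⟩)
  map_mul' p q := by
    induction p using DenseEnd.ind with | h f =>
    induction q using DenseEnd.ind with | h g =>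
    refine DenseEnd.mk_eq_of fun x h₁ h₂ => ?_
    exact congrArg (fun z => e (f.1 z)) (Subtype.ext (e.symm_apply_apply _).symm)

end Transport

/-! ## The involution and the maximal rings of quotients -/

section StarMax

variable (R : Type u) [Ring R] [StarRing R]

theorem starAddEquiv_smul (a : Rᵐᵒᵖ) (m : R) :
    (starAddEquiv : R ≃+ R) (a • m) = (starRingEquiv : R ≃+* Rᵐᵒᵖ).symm a • starAddEquiv m :=
  star_mul m a.unop

/-- Conjugation with the involution, as an antiisomorphism between the maximal rings of
quotients. -/
def starMax : MaxLeft R ≃+* (MaxRight R)ᵐᵒᵖ :=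
  RingEquiv.op (transportEquiv (starRingEquiv : R ≃+* Rᵐᵒᵖ).symm (starAddEquiv : R ≃+ R)
    (starAddEquiv_smul R)).symm

variable {R}

theorem starMax_toMaxLeft (r : R) : starMax R (toMaxLeft R r) = op (toMaxRight R (star r)) :=
  congrArg op (DenseEnd.mk_eq_of fun x _ _ => by
    change star (star x * r) = star r * x
    rw [star_mul, star_star])

theorem starMax_symm_toMaxRight (r : R) :
    (starMax R).symm (op (toMaxRight R r)) = toMaxLeft R (star r) := by
  rw [RingEquiv.symm_apply_eq, starMax_toMaxLeft, star_star]

/-- Applying `*` to `f i * j = i * g j` gives `(g j)* * i* = j* * (f i)*`, the compatibility of the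
conjugate of `g` with that of `f`. -/
theorem starMax_swap_mem {q : MaxLeft R × MaxRight R} (hq : q ∈ MaxSymm R) :
    ((starMax R).symm (op q.2), (starMax R q.1).unop) ∈ MaxSymm R := by
  obtain ⟨f, g, h, rfl⟩ := hq
  refine ⟨_, _, fun i j => ?_, rfl⟩
  have := congrArg star (h ⟨star j.1, j.2⟩ ⟨star i.1, i.2⟩)
  rw [star_mul, star_mul, star_star, star_star] at this
  exact this.symm

instance starRingMaxSymm : StarRing (MaxSymm R) where
  star q := ⟨_, starMax_swap_mem q.2⟩
  star_involutive q := Subtype.ext (Prod.ext (by simp) (by simp))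
  star_mul p q := Subtype.ext (Prod.ext (by simp) (by simp))
  star_add p q := Subtype.ext (Prod.ext (by simp) (by simp))

theorem star_toMaxSymm (r : R) : star (toMaxSymm R r) = toMaxSymm R (star r) :=
  Subtype.ext (Prod.ext (starMax_symm_toMaxRight r) (congrArg unop (starMax_toMaxLeft r)))

/-- An antiisomorphism over the involution maps intermediate perfect left rings of quotients to
perfect right ones. -/
theorem isPerfectRight_antiSubring {Q Q' : Type u} [Ring Q] [Ring Q'] {ι : R →+* Q} {ι' : R →+* Q'}
    (σ : Q ≃+* Q'ᵐᵒᵖ) (hσ : ∀ r, σ (ι r) = op (ι' (star r))) {S : Subring Q} (h : ∀ r, ι r ∈ S)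
    (hS : IsPerfectLeft (ι.codRestrict S h)) (h' : ∀ r, ι' r ∈ antiSubring σ S) :
    IsPerfectRight (ι'.codRestrict (antiSubring σ S) h') :=
  hS.anti (antiRestrict σ S _ fun _ => Iff.rfl) fun r => by
    have e := congrArg unop (hσ r)
    exact congrArg op (Subtype.ext e)

theorem isPerfectLeft_antiSubring {Q Q' : Type u} [Ring Q] [Ring Q'] {ι : R →+* Q} {ι' : R →+* Q'}
    (σ : Q ≃+* Q'ᵐᵒᵖ) (hσ : ∀ r, σ (ι r) = op (ι' (star r))) {S : Subring Q} (h : ∀ r, ι r ∈ S)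
    (hS : IsPerfectRight (ι.codRestrict S h)) (h' : ∀ r, ι' r ∈ antiSubring σ S) :
    IsPerfectLeft (ι'.codRestrict (antiSubring σ S) h') :=
  hS.anti (antiRestrict σ S _ fun _ => Iff.rfl) fun r => by
    have e := congrArg unop (hσ r)
    exact congrArg op (Subtype.ext e)

theorem mem_antiSubring_of_anti {Q Q' : Type u} [Ring Q] [Ring Q'] {ι : R →+* Q} {ι' : R →+* Q'}
    (σ : Q ≃+* Q'ᵐᵒᵖ) (hσ : ∀ r, σ (ι r) = op (ι' (star r))) {S : Subring Q} (h : ∀ r, ι r ∈ S)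
    (r : R) : ι' r ∈ antiSubring σ S := by
  rw [mem_antiSubring, show op (ι' r) = σ (ι (star r)) by rw [hσ, star_star],
    RingEquiv.symm_apply_apply]
  exact h _

/-- `starMax` and the antiisomorphism in the opposite direction carry the generating families of
`TotLeft R` and `TotRight R` into each other. -/
theorem mem_totRight_iff (x : MaxRight R) :
    x ∈ TotRight R ↔ (starMax R).symm (op x) ∈ TotLeft R := by
  have h₁ : TotLeft R ≤
      antiSubring (RingEquiv.opOp _ |>.trans (starMax R).symm.op) (TotRight R) := by
    refine sSup_le fun S ⟨h, hS⟩ x hx => ?_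
    have := mem_antiSubring_of_anti _ starMax_toMaxLeft h
    have hle : antiSubring (starMax R) S ≤ TotRight R :=
      le_sSup ⟨this, isPerfectRight_antiSubring _ starMax_toMaxLeft h hS this⟩
    exact hle (unop_mem_antiSubring.2 hx)
  have h₂ : TotRight R ≤ antiSubring (starMax R) (TotLeft R) := by
    refine sSup_le fun S ⟨h, hS⟩ x hx => ?_
    have hσ : ∀ r, (RingEquiv.opOp _ |>.trans (starMax R).symm.op) (toMaxRight R r) =
      op (toMaxLeft R (star r)) := fun r => congrArg op (starMax_symm_toMaxRight r)
    have := mem_antiSubring_of_anti _ hσ h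
    have hle : antiSubring _ S ≤ TotLeft R :=
      le_sSup ⟨this, isPerfectLeft_antiSubring _ hσ h hS this⟩
    exact hle (unop_mem_antiSubring.2 hx)
  refine ⟨fun h => h₂ h, fun h => ?_⟩
  have := h₁ h
  rw [mem_antiSubring] at this
  simpa using this

/-- The involution exchanges left and right perfectness, hence permutes the rings generating
`TotSymm R`. -/
theorem star_mem_totSymm {x : MaxSymm R} (hx : x ∈ TotSymm R) : star x ∈ TotSymm R := by
  have hle : TotSymm R ≤ antiSubring (starRingEquiv : MaxSymm R ≃+* _) (TotSymm R) := by
    refine sSup_le fun S ⟨h, hl, hr⟩ x hx => ?_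
    have hσ : ∀ r, (starRingEquiv : MaxSymm R ≃+* _) (toMaxSymm R r) =
      op (toMaxSymm R (star r)) := fun r => congrArg op (star_toMaxSymm r)
    have := mem_antiSubring_of_anti _ hσ h
    have hle : antiSubring _ S ≤ TotSymm R :=
      le_sSup ⟨this, isPerfectLeft_antiSubring _ hσ h hr this,
        isPerfectRight_antiSubring _ hσ h hl this⟩
    exact hle (unop_mem_antiSubring.2 hx)
  exact hle hx

instance starRingTotSymm : StarRing (TotSymm R) where
  star q := ⟨star q.1, star_mem_totSymm q.2⟩
  star_involutive q := Subtype.ext (star_star q.1)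
  star_mul p q := Subtype.ext (star_mul p.1 q.1)
  star_add p q := Subtype.ext (star_add p.1 q.1)

end StarMax

/-! ## Rings of quotients that are equal over `R` -/

section EqualOver

variable {R Q Q' Q'' : Type u} [Ring R] [Ring Q] [Ring Q'] [Ring Q''] {ι : R →+* Q} {ι' : R →+* Q'}
  {ι'' : R →+* Q''}

theorem EqualOver.symm : EqualOver ι ι' → EqualOver ι' ι := fun ⟨e, he⟩ =>
  ⟨e.symm, fun r => by rw [RingEquiv.symm_apply_eq, he]⟩

theorem EqualOver.trans : EqualOver ι ι' → EqualOver ι' ι'' → EqualOver ι ι'' :=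
  fun ⟨e, he⟩ ⟨e', he'⟩ => ⟨e.trans e', fun r => by rw [RingEquiv.trans_apply, he, he']⟩

/-- The composite of two antiisomorphisms `q ↦ σ (q*)` is an isomorphism, and it fixes `R` because
`r** = r`. -/
theorem InvolutionExtends.equalOver [StarRing R] (h : InvolutionExtends ι) (σ : Q ≃+* Q'ᵐᵒᵖ)
    (hσ : ∀ r, σ (ι r) = op (ι' (star r))) : EqualOver ι ι' := by
  obtain ⟨_, hs⟩ := h
  refine ⟨(starRingEquiv.trans (RingEquiv.op σ)).trans (RingEquiv.opOp Q').symm, fun r => ?_⟩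
  simp [hs, hσ]

theorem InvolutionExtends.equalOver' [StarRing R] (h : InvolutionExtends ι') (σ : Q ≃+* Q'ᵐᵒᵖ)
    (hσ : ∀ r, σ (ι r) = op (ι' (star r))) : EqualOver ι ι' := by
  obtain ⟨_, hs⟩ := h
  refine ⟨σ.trans starRingEquiv.symm, fun r => ?_⟩
  rw [RingEquiv.trans_apply, RingEquiv.symm_apply_eq, hσ, starRingEquiv_apply, hs]

end EqualOver

/-! ## Rings over `R` inside both one-sided maximal rings of quotients -/

section Both

variable {R : Type u} [Ring R]

theorem mk_mul_toMaxRight (g : DensePMap Rᵐᵒᵖ R) (j : g.1.domain) :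
    DenseEnd.mk g * toMaxRight R j = toMaxRight R (g.1 j) :=
  DenseEnd.mk_eq_of fun x _ _ => g.1.map_smul (op x) j

theorem toMaxLeft_mul_mk (f : DensePMap R R) (i : f.1.domain) :
    toMaxLeft R i * op (DenseEnd.mk f) = toMaxLeft R (f.1 i) :=
  congrArg op (DenseEnd.mk_eq_of fun x _ _ => f.1.map_smul x i)

theorem maxSymm_snd_injective :
    Function.Injective ((RingHom.snd (MaxLeft R) (MaxRight R)).comp (MaxSymm R).subtype) := by
  rw [injective_iff_map_eq_zero]
  rintro ⟨_, f, g, h, rfl⟩ hg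
  obtain ⟨N, hN, hgN⟩ := DenseEnd.mk_eq_mk.1 (show DenseEnd.mk g = DenseEnd.mk _ from hg)
  refine Subtype.ext (Prod.ext (congrArg op (DenseEnd.mk_eq_of fun x hx _ => ?_)) hg)
  by_contra hne
  -- If `g` vanishes on the dense right ideal `N`, then `f x * n = x * g n = 0` for `n ∈ N`, while
  -- density of `N` at the pair `1, f x` supplies some `n ∈ N` with `f x * n ≠ 0`.
  obtain ⟨a, ha, hay⟩ := hN 1 (f.1 ⟨x, hx⟩) hne
  obtain ⟨hd, _, e⟩ := hgN _ ha
  apply hay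
  have := h ⟨x, hx⟩ ⟨_, hd⟩
  rw [e] at this
  change f.1 ⟨x, hx⟩ * (1 * a.unop) = x * 0 at this
  rw [one_mul, mul_zero] at this
  exact this

variable {Q : Type u} [Ring Q] {ι : R →+* Q}

/-- A ring over `R` that embeds into the maximal right ring of quotients and maps to the maximal
left ring of quotients maps to the maximal symmetric ring of quotients. -/
theorem prod_mem_maxSymm (a : Q →+* MaxRight R) (ha : Function.Injective a)
    (haι : ∀ r, a (ι r) = toMaxRight R r) (b : Q →+* MaxLeft R)
    (hbι : ∀ r, b (ι r) = toMaxLeft R r) (x : Q) : (b x, a x) ∈ MaxSymm R := by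
  obtain ⟨f, hf⟩ : ∃ f : DensePMap R R, op (DenseEnd.mk f) = b x := by
    obtain ⟨f, hf⟩ := Quotient.exists_rep (b x).unop
    exact ⟨f, congrArg op hf⟩
  obtain ⟨g, hg⟩ : ∃ g, DenseEnd.mk g = a x := Quotient.exists_rep (a x)
  refine ⟨f, g, fun i j => toMaxLeft_injective R ?_, by rw [hf, hg]⟩
  -- The relation `x j = g j` is read off in the right ring and pulled back to `Q` by injectivity of
  -- `a`. Pushed to the left ring by `b`, it gives `f i * j = i * b x * j = i * g j`.
  have hj : x * ι j = ι (g.1 j) := ha (by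
    rw [map_mul, haι, haι, ← hg, mk_mul_toMaxRight])
  rw [map_mul, map_mul, ← toMaxLeft_mul_mk, hf, mul_assoc, ← hbι j, ← map_mul, hj, hbι]

/-- The homomorphism to the maximal symmetric ring of quotients with given components. -/
def toMaxSymmOfBoth (a : Q →+* MaxRight R) (ha : Function.Injective a)
    (haι : ∀ r, a (ι r) = toMaxRight R r) (b : Q →+* MaxLeft R)
    (hbι : ∀ r, b (ι r) = toMaxLeft R r) : Q →+* MaxSymm R :=
  (b.prod a).codRestrict _ (prod_mem_maxSymm a ha haι b hbι)

end Both

/-! ### Comparison of the one-sided rings of quotients with the symmetric ones -/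

section Main

variable {R : Type u} [Ring R]

theorem EqualOver.maxRight_maxSymm (h : EqualOver (toMaxRight R) (toMaxLeft R)) :
    EqualOver (toMaxRight R) (toMaxSymm R) := by
  obtain ⟨e, he⟩ := h
  let c := toMaxSymmOfBoth (RingHom.id _) Function.injective_id (fun r => rfl)
    (e : MaxRight R →+* MaxLeft R) he
  refine ⟨RingEquiv.ofBijective c ⟨fun x y hxy => congrArg (fun q : MaxSymm R => q.1.2) hxy,
    fun q => ⟨q.1.2, maxSymm_snd_injective rfl⟩⟩, fun r => maxSymm_snd_injective rfl⟩

theorem isPerfectRight_totRight : IsPerfectRight (toTotRight R) :=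
  isPerfectRight_sSup _ (toMaxRight_injective R) _

/-- The antiisomorphism between the total one-sided rings of quotients. -/
def starTot [StarRing R] : TotLeft R ≃+* (TotRight R)ᵐᵒᵖ :=
  antiRestrict (starMax R) _ _ mem_totRight_iff

theorem starTot_toTotLeft [StarRing R] (r : R) :
    starTot (toTotLeft R r) = op (toTotRight R (star r)) :=
  unop_injective (Subtype.ext (congrArg unop (starMax_toMaxLeft r)))

theorem isPerfectLeft_totLeft [StarRing R] : IsPerfectLeft (toTotLeft R) := by
  refine isPerfectRight_totRight.anti ((RingEquiv.opOp _).trans (starTot (R := R)).symm.op)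
    fun r => congrArg op ?_
  change starTot.symm (op (toTotRight R r)) = _
  rw [RingEquiv.symm_apply_eq, starTot_toTotLeft, star_star]

theorem EqualOver.totRight_totSymm [StarRing R] (h : EqualOver (toTotRight R) (toTotLeft R)) :
    EqualOver (toTotRight R) (toTotSymm R) := by
  obtain ⟨e, he⟩ := h
  let c : TotRight R →+* MaxSymm R := toMaxSymmOfBoth (ι := toTotRight R) (TotRight R).subtype
    Subtype.val_injective (fun r => rfl) ((TotLeft R).subtype.comp e)
    fun r => congrArg Subtype.val (he r)
  have hc : Function.Injective c := fun x y hxy =>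
    Subtype.ext (congrArg (fun q : MaxSymm R => q.1.2) hxy)
  have hcι : ∀ r, c (toTotRight R r) = toMaxSymm R r := fun r => maxSymm_snd_injective rfl
  have hmem : ∀ r, toMaxSymm R r ∈ c.range := fun r => ⟨_, hcι r⟩
  let ce : TotRight R ≃+* c.range := RingEquiv.ofBijective c.rangeRestrict
    ⟨fun x y hxy => hc (congrArg Subtype.val hxy), c.rangeRestrict_surjective⟩
  -- The image of `c` is a copy of `TotRight R`, and through `e` also of `TotLeft R`, so it is
  -- perfect on both sides.
  have hle : c.range ≤ TotSymm R := le_sSup ⟨hmem,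
    isPerfectLeft_totLeft.congr (e.symm.trans ce) fun r => Subtype.ext (by
      rw [← he, RingEquiv.trans_apply, RingEquiv.symm_apply_apply]
      exact hcι r),
    isPerfectRight_totRight.congr ce fun r => Subtype.ext (hcι r)⟩
  -- A perfect symmetric ring projects isomorphically onto a perfect right ring inside `MaxRight R`,
  -- hence into `TotRight R`; injectivity of the projection recovers the pair.
  have hge : TotSymm R ≤ c.range := by
    refine sSup_le fun S ⟨h, _, hr⟩ q hq => ?_
    let p : MaxSymm R →+* MaxRight R := (RingHom.snd _ _).comp (MaxSymm R).subtype
    have hp : S.map p ≤ TotRight R := le_sSup ⟨fun r => ⟨_, h r, rfl⟩,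
      hr.congr (S.equivMapOfInjective p maxSymm_snd_injective) fun r => Subtype.ext rfl⟩
    exact ⟨⟨p q, hp ⟨q, hq, rfl⟩⟩, maxSymm_snd_injective rfl⟩
  refine ⟨RingEquiv.ofBijective (c.codRestrict (TotSymm R) fun x => hle ⟨x, rfl⟩)
    ⟨fun x y hxy => hc (congrArg Subtype.val hxy), fun q => ?_⟩, fun r => Subtype.ext (hcι r)⟩
  obtain ⟨x, hx⟩ := hge q.2
  exact ⟨x, Subtype.ext hx⟩

end Main

end QuotientRings
end
theorem mainTheorem8 (R : Type u) [Ring R] [StarRing R] :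
    (QuotientRings.InvolutionExtends (QuotientRings.toMaxSymm R) ∧
      QuotientRings.InvolutionExtends (QuotientRings.toTotSymm R)) ∧
    (QuotientRings.InvolutionExtends (QuotientRings.toMaxRight R) ∨
        QuotientRings.InvolutionExtends (QuotientRings.toMaxLeft R) →
      QuotientRings.EqualOver (QuotientRings.toMaxRight R) (QuotientRings.toMaxLeft R) ∧
      QuotientRings.EqualOver (QuotientRings.toMaxLeft R) (QuotientRings.toMaxSymm R)) ∧
    (QuotientRings.InvolutionExtends (QuotientRings.toTotRight R) ∨
        QuotientRings.InvolutionExtends (QuotientRings.toTotLeft R) →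
      QuotientRings.EqualOver (QuotientRings.toTotRight R) (QuotientRings.toTotLeft R) ∧
      QuotientRings.EqualOver (QuotientRings.toTotLeft R) (QuotientRings.toTotSymm R)) := by
  refine ⟨⟨⟨inferInstance, QuotientRings.star_toMaxSymm⟩, inferInstance,
    fun r => Subtype.ext (QuotientRings.star_toMaxSymm r)⟩, fun h => ?_, fun h => ?_⟩
  · have e : QuotientRings.EqualOver (QuotientRings.toMaxLeft R) (QuotientRings.toMaxRight R) :=
      h.elim (fun h => h.equalOver' _ QuotientRings.starMax_toMaxLeft)
        fun h => h.equalOver _ QuotientRings.starMax_toMaxLeft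
    exact ⟨e.symm, e.trans e.symm.maxRight_maxSymm⟩
  · have e : QuotientRings.EqualOver (QuotientRings.toTotLeft R) (QuotientRings.toTotRight R) :=
      h.elim (fun h => h.equalOver' _ QuotientRings.starTot_toTotLeft)
        fun h => h.equalOver _ QuotientRings.starTot_toTotLeft
    exact ⟨e.symm, e.trans e.symm.totRight_totSymm⟩
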